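/- **Theorem.** Let $k$ be a field, $N\cong\mathbb Z^r$ a lattice, $M=\operatorname{Hom}(N,\mathbb Z)$, $\Sigma$ a complete fan in $N_{\mathbb R}$, and $X=X(\Sigma)$ the corresponding toric variety over $k$, with dense torus $T=\operatorname{Spec}k[M]$. Let $n\ge 0$ and $q\ge 2$ be integers, and let $F\colon X^n\to X^n$ be the $k$-morphism induced by multiplication by $q$ on $N^n$ (on $T^n$ it is $x^u\mapsto x^{qu}$). A *splitting of $X^n$ at $q$* is a map of $\mathcal O_{X^n}$-modules $\pi\colon F_*\mathcal O_{X^n}\to\mathcal O_{X^n}$ whose composition with $\mathcal O_{X^n}\to F_*\mathcal O_{X^n}$ is the identity. It is *compatible* with a closed subset $Z\subset X^n$, with reduced ideal sheaf $I_Z$, if $\pi(F_*I_Z)\subset I_Z$. Let $\Delta\subset X\times X$ be the diagonal and, for $1\le i\le n-1$, let $\Delta_i=X^{i-1}\times\Delta\times X^{n-i-1}\subset X^n$, and let $L_i\subset M^n$ be the sublattice of tuples $(u_1,\dots,u_n)$ with $u_1+\cdots+u_n=0$ and $u_j=0$ for $j\notin\{i,i+1\}$. Write the monomials in $\Gamma(T^n,F_*\mathcal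 O)$ as $x^b$ with $b\in\frac1qM^n$ (as a function on $T^n$, $x^b$ is $x^{qb}$), and for $a\in\frac1qM^n$ let $\pi_a$ be the map over $T^n$ with $\pi_a(x^b)=x^{a+b}$ if $a+b\in M^n$ and $\pi_a(x^b)=0$ otherwise. Let $\pi$ be a splitting of $X^n$ at $q$ whose restriction to $T^n$ is the finite sum $\pi=\sum_{a\in\frac1qM^n}c_a\pi_a$ with $c_a\in k$. Then $\pi$ is compatible with $\Delta_1\cup\cdots\cup\Delta_{n-1}$ if and only if for every $1\le i\le n-1$, all $b,b'\in\frac1qM^n$ with $b\equiv b'\bmod\frac1qL_i$, and every class $[u]\in M^n/L_i$, $$\sum_{\substack{a+b\,\in\,M^n\\ (a+b)\bmod L_i\,=\,[u]}}c_a\;=\;\sum_{\substack{a'+b'\,\in\,M^n\\ (a'+b')\bmod L_i\,=\,[u]}}c_{a'} .$$ -/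

import Mathlib

universe u

open CategoryTheory Limits AlgebraicGeometry
open scoped TensorProduct

noncomputable section

namespace ToricSplitting

/-! ### Lattices, cones and fans -/

section Fans

variable (N : Type u) [AddCommGroup N]

/-- The real vector space `N_ℝ = ℝ ⊗ N`. -/
abbrev NR : Type u := ℝ ⊗[ℤ] N

/-- The real vector space `M_ℝ = Hom(N, ℝ)`, which contains `M = Hom(N, ℤ)`. -/
abbrev MR : Type u := N →ₗ[ℤ] ℝ

variable {N}

/-- The pairing `⟨m, x⟩` of `m ∈ M_ℝ` and `x ∈ N_ℝ`. -/
def pair (m : MR N) : NR N →ₗ[ℝ] ℝ := LinearMap.liftBaseChange ℝ m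

lemma pair_add (m m' : MR N) (x : NR N) : pair (m + m') x = pair m x + pair m' x := by
  simp [pair, map_add]

lemma pair_zero (x : NR N) : pair (0 : MR N) x = 0 := by
  simp [pair]

variable (N)

/-- The dual lattice `M = Hom(N, ℤ)`, as the group of the integer valued functionals in `M_ℝ`. -/
def latM : AddSubgroup (MR N) where
  carrier := {m | ∀ v : N, ∃ z : ℤ, m v = z}
  add_mem' {a b} ha hb v := by
    obtain ⟨y, hy⟩ := ha v
    obtain ⟨z, hz⟩ := hb v
    exact ⟨y + z, by simp [hy, hz]⟩
  zero_mem' _ := ⟨0, by simp⟩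
  neg_mem' {a} ha v := by
    obtain ⟨y, hy⟩ := ha v
    exact ⟨-y, by simp [hy]⟩

variable {N}

/-- `τ` is a face of the (rational polyhedral) cone `σ`: there is a lattice point `m ∈ M`,
nonnegative on `σ`, such that `τ = σ ∩ m^⊥`. -/
def IsFace (τ σ : PointedCone ℝ (NR N)) : Prop :=
  ∃ m ∈ latM N, (∀ x ∈ σ, 0 ≤ pair m x) ∧ ∀ x, x ∈ τ ↔ x ∈ σ ∧ pair m x = 0

variable (N)

/-- A (nonempty) fan: a finite set of strongly convex rational polyhedral cones in `N_ℝ`, closed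
under taking faces, in which any two cones meet in a common face. As `{0}` is a face of
every strongly convex rational polyhedral cone, being nonempty amounts to containing `{0}`. -/
structure Fan where
  cones : Set (PointedCone ℝ (NR N))
  finite : cones.Finite
  rational : ∀ σ ∈ cones, ∃ s : Finset N,
    σ = PointedCone.hull ℝ ((fun v : N => ((1 : ℝ) ⊗ₜ[ℤ] v : NR N)) '' s)
  strongly_convex : ∀ σ ∈ cones, ∀ x ∈ σ, -x ∈ σ → x = 0
  zero_mem : ⊥ ∈ cones
  face_mem : ∀ σ ∈ cones, ∀ τ, IsFace τ σ → τ ∈ cones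
  inter_face : ∀ σ ∈ cones, ∀ τ ∈ cones, IsFace (σ ⊓ τ) σ ∧ IsFace (σ ⊓ τ) τ

variable {N}

/-- A fan is complete if its cones cover `N_ℝ`. -/
def Fan.IsComplete (S : Fan N) : Prop := ∀ x : NR N, ∃ σ ∈ S.cones, x ∈ σ

/-- The monoid `σ^∨ ∩ M`. -/
def dualMonoid (σ : PointedCone ℝ (NR N)) : AddSubmonoid (MR N) where
  carrier := {m | m ∈ latM N ∧ ∀ x ∈ σ, 0 ≤ pair m x}
  add_mem' {a b} ha hb := ⟨add_mem ha.1 hb.1, fun x hx => by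
    rw [pair_add]; exact add_nonneg (ha.2 x hx) (hb.2 x hx)⟩
  zero_mem' := ⟨zero_mem _, fun x _ => by rw [pair_zero]⟩

lemma dualMonoid_anti {τ σ : PointedCone ℝ (NR N)} (h : τ ≤ σ) : dualMonoid σ ≤ dualMonoid τ :=
  fun _ hm => ⟨hm.1, fun x hx => hm.2 x (h hx)⟩

lemma mem_dualMonoid_bot {m : MR N} (hm : m ∈ latM N) : m ∈ dualMonoid (⊥ : PointedCone ℝ (NR N)) :=
  ⟨hm, fun x hx => by rw [(Submodule.mem_bot _).1 hx, map_zero]⟩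

end Fans

/-! ### The toric variety of a fan -/

section Toric

variable (k : Type u) [Field k] {N : Type u} [AddCommGroup N]

/-- The ring `k[σ^∨ ∩ M]`. -/
abbrev coordRing (σ : PointedCone ℝ (NR N)) : Type u := AddMonoidAlgebra k (dualMonoid σ)

/-- The inclusion `k[σ^∨ ∩ M] ⊆ k[τ^∨ ∩ M]` for `τ ⊆ σ`. -/
def resRing {τ σ : PointedCone ℝ (NR N)} (h : τ ≤ σ) : coordRing k σ →+* coordRing k τ :=
  AddMonoidAlgebra.mapDomainRingHom k (AddSubmonoid.inclusion (dualMonoid_anti h))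

/-- The ring endomorphism `x^u ↦ x^{q u}` of `k[σ^∨ ∩ M]`. -/
def mulRing (q : ℕ) (σ : PointedCone ℝ (NR N)) : coordRing k σ →+* coordRing k σ :=
  AddMonoidAlgebra.mapDomainRingHom k (nsmulAddMonoidHom q)

variable {k}

lemma resRing_single {τ σ : PointedCone ℝ (NR N)} (h : τ ≤ σ) (m : dualMonoid σ) (c : k) :
    resRing k h (AddMonoidAlgebra.single m c) =
      AddMonoidAlgebra.single (AddSubmonoid.inclusion (dualMonoid_anti h) m) c :=
  AddMonoidAlgebra.mapDomain_single

lemma mulRing_single (q : ℕ) (σ : PointedCone ℝ (NR N)) (m : dualMonoid σ) (c : k) :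
    mulRing k q σ (AddMonoidAlgebra.single m c) = AddMonoidAlgebra.single (q • m) c :=
  AddMonoidAlgebra.mapDomain_single

lemma pair_gen_int {m : MR N} (hm : m ∈ latM N) (v : N) : ∃ z : ℤ, pair m (1 ⊗ₜ v) = z := by
  obtain ⟨z, hz⟩ := hm v
  exact ⟨z, by simp [pair, hz]⟩

/-- If `τ = σ ∩ m^⊥` is a face of `σ`, then every `w ∈ τ^∨ ∩ M` becomes an element of `σ^∨ ∩ M`
after adding a multiple of `m`. -/
lemma exists_add_mem {τ σ : PointedCone ℝ (NR N)} {s : Finset N}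
    (hs : σ = PointedCone.hull ℝ ((fun v : N => ((1 : ℝ) ⊗ₜ[ℤ] v : NR N)) '' s))
    {m : MR N} (hm : m ∈ latM N) (hpos : ∀ x ∈ σ, 0 ≤ pair m x)
    (hτ : ∀ x, x ∈ τ ↔ x ∈ σ ∧ pair m x = 0) {w : MR N} (hw : w ∈ dualMonoid τ) :
    ∃ n : ℕ, w + n • m ∈ dualMonoid σ := by
  have hsm : ∀ (n : ℕ) (x : NR N), pair (n • m) x = n * pair m x := by
    intro n x
    induction n with
    | zero => simp [pair_zero]
    | succ n ih => rw [succ_nsmul, pair_add, ih]; push_cast; ring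
  have hmem : ∀ v ∈ s, ((1 : ℝ) ⊗ₜ[ℤ] v : NR N) ∈ σ := fun v hv => by
    rw [hs]; exact PointedCone.subset_hull ⟨v, hv, rfl⟩
  have key : ∀ v ∈ s, ∃ n : ℕ, 0 ≤ pair w (1 ⊗ₜ v) + n * pair m (1 ⊗ₜ v) := by
    intro v hv
    obtain ⟨z, hz⟩ := pair_gen_int hm v
    have h0 := hpos _ (hmem v hv)
    rcases h0.eq_or_lt with h | h
    · exact ⟨0, by simpa using hw.2 _ ((hτ _).2 ⟨hmem v hv, h.symm⟩)⟩
    · obtain ⟨n, hn⟩ := exists_nat_ge (-pair w (1 ⊗ₜ v))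
      have h1 : (1 : ℝ) ≤ pair m (1 ⊗ₜ v) := by
        rw [hz] at h ⊢
        have : 0 < z := by exact_mod_cast h
        exact_mod_cast this
      refine ⟨n, ?_⟩
      nlinarith [(Nat.cast_nonneg n : (0 : ℝ) ≤ n)]
  choose! f hf using key
  refine ⟨∑ v ∈ s, f v, add_mem hw.1 (nsmul_mem hm _), ?_⟩
  intro x hx
  rw [hs] at hx
  induction hx using Submodule.span_induction with
  | mem x hx =>
    obtain ⟨v, hv, rfl⟩ := hx
    have h1 := hf v hv
    have h2 : (f v : ℝ) ≤ ((∑ v ∈ s, f v : ℕ) : ℝ) := by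
      exact_mod_cast Finset.single_le_sum (f := f) (fun _ _ => Nat.zero_le _) hv
    have h3 := hpos _ (hmem v hv)
    dsimp only
    rw [pair_add, hsm]
    nlinarith
  | zero => simp
  | add x y _ _ hx hy => rw [map_add]; exact add_nonneg hx hy
  | smul a x _ hx =>
    have : a • x = (a : ℝ) • x := rfl
    rw [this, map_smul, smul_eq_mul]
    exact mul_nonneg a.2 hx

/-- If `τ = σ ∩ m^⊥`, then `k[τ^∨ ∩ M]` is the localization of `k[σ^∨ ∩ M]` at `x^m`. -/
lemma isLocalization_res {τ σ : PointedCone ℝ (NR N)} (h : τ ≤ σ) {s : Finset N}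
    (hs : σ = PointedCone.hull ℝ ((fun v : N => ((1 : ℝ) ⊗ₜ[ℤ] v : NR N)) '' s))
    (m : dualMonoid σ) (hτ : ∀ x, x ∈ τ ↔ x ∈ σ ∧ pair m.1 x = 0) :
    let _ := (resRing k h).toAlgebra
    IsLocalization.Away (AddMonoidAlgebra.single m 1 : coordRing k σ) (coordRing k τ) := by
  let _ := (resRing k h).toAlgebra
  have halg : ∀ a, algebraMap (coordRing k σ) (coordRing k τ) a = resRing k h a := fun _ => rfl
  have hneg : -m.1 ∈ dualMonoid τ := ⟨neg_mem m.2.1, fun x hx => by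
    have h0 := pair_add m.1 (-m.1) x
    rw [add_neg_cancel, pair_zero, ((hτ x).1 hx).2] at h0
    linarith⟩
  refine IsLocalization.Away.mk _ ?_ ?_ ?_
  · rw [halg, resRing_single]
    refine IsUnit.of_mul_eq_one (AddMonoidAlgebra.single ⟨-m.1, hneg⟩ 1) ?_
    rw [AddMonoidAlgebra.single_mul_single, AddMonoidAlgebra.one_def]
    congr 1
    · ext1; simp
    · simp
  · intro z
    induction z using AddMonoidAlgebra.induction_linear with
    | zero => exact ⟨0, 0, by simp⟩
    | add x y hx hy =>
      obtain ⟨n, a, ha⟩ := hx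
      obtain ⟨p, b, hb⟩ := hy
      refine ⟨n + p, a * AddMonoidAlgebra.single m 1 ^ p + b * AddMonoidAlgebra.single m 1 ^ n, ?_⟩
      rw [map_add, map_mul, map_mul, ← ha, ← hb, map_pow, map_pow]
      ring
    | single w c =>
      obtain ⟨n, hn⟩ := exists_add_mem hs m.2.1 m.2.2 hτ w.2
      refine ⟨n, AddMonoidAlgebra.single ⟨_, hn⟩ c, ?_⟩
      rw [halg, halg, resRing_single, resRing_single, AddMonoidAlgebra.single_pow,
        AddMonoidAlgebra.single_mul_single]
      congr 1
      simp
  · intro a b hab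
    refine ⟨0, ?_⟩
    rw [(AddMonoidAlgebra.mapDomain_injective (AddSubmonoid.inclusion_injective _) hab : a = b)]

lemma isOpenImmersion_res {τ σ : PointedCone ℝ (NR N)} (h : τ ≤ σ) {s : Finset N}
    (hs : σ = PointedCone.hull ℝ ((fun v : N => ((1 : ℝ) ⊗ₜ[ℤ] v : NR N)) '' s))
    (m : dualMonoid σ) (hτ : ∀ x, x ∈ τ ↔ x ∈ σ ∧ pair m.1 x = 0) :
    IsOpenImmersion (Spec.map (CommRingCat.ofHom (resRing k h))) := by
  let _ := (resRing k h).toAlgebra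
  have := isLocalization_res (k := k) h hs m hτ
  exact IsOpenImmersion.of_isLocalization (AddMonoidAlgebra.single m 1 : coordRing k σ)

lemma range_res {τ σ : PointedCone ℝ (NR N)} (h : τ ≤ σ) {s : Finset N}
    (hs : σ = PointedCone.hull ℝ ((fun v : N => ((1 : ℝ) ⊗ₜ[ℤ] v : NR N)) '' s))
    (m : dualMonoid σ) (hτ : ∀ x, x ∈ τ ↔ x ∈ σ ∧ pair m.1 x = 0)
    (p : Spec (CommRingCat.of (coordRing k σ))) :
    (∃ y, Spec.map (CommRingCat.ofHom (resRing k h)) y = p) ↔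
      (AddMonoidAlgebra.single m 1 : coordRing k σ) ∉ p.asIdeal := by
  let _ := (resRing k h).toAlgebra
  have := isLocalization_res (k := k) h hs m hτ
  have h2 := PrimeSpectrum.localization_away_comap_range (coordRing k τ)
    (AddMonoidAlgebra.single m 1 : coordRing k σ)
  exact Set.ext_iff.1 h2 p

variable (k)

/-- The affine charts `U_σ = Spec k[σ^∨ ∩ M]` for `σ` in the fan `S`, with their inclusions. -/
def charts (S : Fan N) : S.cones ⥤ Scheme.{u} where
  obj σ := Spec (CommRingCat.of (coordRing k σ.1))
  map {τ σ} f := Spec.map (CommRingCat.ofHom (resRing k (leOfHom f : τ.1 ≤ σ.1)))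
  map_id σ := by
    rw [← Spec.map_id]
    congr 1
    refine CommRingCat.hom_ext (AddMonoidAlgebra.ringHom_ext (fun c => ?_) (fun m => ?_)) <;>
    · rw [CommRingCat.hom_ofHom, resRing_single]
      rfl
  map_comp {ρ τ σ} f g := by
    rw [← Spec.map_comp, ← CommRingCat.ofHom_comp]
    congr 2
    refine AddMonoidAlgebra.ringHom_ext (fun c => ?_) (fun m => ?_) <;>
    · rw [RingHom.comp_apply, resRing_single, resRing_single, resRing_single]
      rfl

variable {k}

lemma Fan.exists_face (S : Fan N) {τ σ : S.cones} (h : τ.1 ≤ σ.1) :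
    ∃ m : dualMonoid σ.1, ∀ x, x ∈ τ.1 ↔ x ∈ σ.1 ∧ pair m.1 x = 0 := by
  obtain ⟨m, hm, hpos, hx⟩ := (S.inter_face τ.1 τ.2 σ.1 σ.2).2
  rw [inf_eq_left.2 h] at hx
  exact ⟨⟨m, hm, hpos⟩, hx⟩

instance (S : Fan N) {τ σ : S.cones} (f : τ ⟶ σ) : IsOpenImmersion ((charts k S).map f) := by
  obtain ⟨s, hs⟩ := S.rational σ.1 σ.2
  obtain ⟨m, hm⟩ := S.exists_face (leOfHom f : τ.1 ≤ σ.1)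
  exact isOpenImmersion_res (leOfHom f : τ.1 ≤ σ.1) hs m hm

lemma Fan.range_charts (S : Fan N) {τ σ : S.cones} (f : τ ⟶ σ)
    {m : dualMonoid σ.1} (hm : ∀ x, x ∈ τ.1 ↔ x ∈ σ.1 ∧ pair m.1 x = 0)
    (p : (charts k S).obj σ) :
    (∃ y, (charts k S).map f y = p) ↔
      (AddMonoidAlgebra.single m 1 : coordRing k σ.1) ∉ PrimeSpectrum.asIdeal p := by
  obtain ⟨s, hs⟩ := S.rational σ.1 σ.2
  exact range_res (leOfHom f : τ.1 ≤ σ.1) hs m hm p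

instance (S : Fan N) : (charts k S ⋙ Scheme.forget).IsLocallyDirected where
  cond := by
    intro i j l fi fj xi xj hx
    obtain ⟨m, hm⟩ := S.exists_face (leOfHom fi : i.1 ≤ l.1)
    obtain ⟨m', hm'⟩ := S.exists_face (leOfHom fj : j.1 ≤ l.1)
    have hx' : (charts k S).map fi xi = (charts k S).map fj xj := hx
    have hmem : i.1 ⊓ j.1 ∈ S.cones := S.face_mem i.1 i.2 _ (S.inter_face i.1 i.2 j.1 j.2).1
    let e : S.cones := ⟨i.1 ⊓ j.1, hmem⟩
    have hei : e ≤ i := show i.1 ⊓ j.1 ≤ i.1 from inf_le_left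
    have hej : e ≤ j := show i.1 ⊓ j.1 ≤ j.1 from inf_le_right
    have hface : ∀ x, x ∈ e.1 ↔ x ∈ l.1 ∧ pair (m + m').1 x = 0 := by
      intro x
      have h1 : x ∈ e.1 ↔ x ∈ i.1 ∧ x ∈ j.1 := Iff.rfl
      rw [h1, hm, hm', AddSubmonoid.coe_add, pair_add]
      constructor
      · rintro ⟨⟨h, h1⟩, _, h2⟩
        exact ⟨h, by rw [h1, h2, add_zero]⟩
      · rintro ⟨h, h1⟩
        have h2 := m.2.2 x h
        have h3 := m'.2.2 x h
        exact ⟨⟨h, by linarith⟩, h, by linarith⟩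
    have h1 := (S.range_charts fi hm ((charts k S).map fi xi)).1 ⟨xi, rfl⟩
    have h2 := (S.range_charts fj hm' ((charts k S).map fi xi)).1 ⟨xj, hx'.symm⟩
    obtain ⟨z, hz⟩ := (S.range_charts (homOfLE (hei.trans (leOfHom fi))) hface
      ((charts k S).map fi xi)).2 (by
        intro h
        have h3 : (AddMonoidAlgebra.single (m + m') 1 : coordRing k l.1) =
            AddMonoidAlgebra.single m 1 * AddMonoidAlgebra.single m' 1 := by
          rw [AddMonoidAlgebra.single_mul_single, one_mul]
        rw [h3] at h
        exact ((PrimeSpectrum.isPrime _).mem_or_mem h).elim h1 h2)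
    refine ⟨e, homOfLE hei, homOfLE hej, z, ?_, ?_⟩
    · apply ((charts k S).map fi).isOpenEmbedding.injective
      change (charts k S).map fi ((charts k S).map (homOfLE hei) z) = (charts k S).map fi xi
      rw [← Scheme.Hom.comp_apply, ← Functor.map_comp]
      exact hz
    · apply ((charts k S).map fj).isOpenEmbedding.injective
      change (charts k S).map fj ((charts k S).map (homOfLE hej) z) = (charts k S).map fj xj
      rw [← Scheme.Hom.comp_apply, ← Functor.map_comp, ← hx']
      exact hz

variable (k)

/-- The toric variety `X = X(S)` over `k`, obtained by gluing the charts `U_σ`. -/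
def toricVariety (S : Fan N) : Scheme.{u} := colimit (charts k S)

/-- The inclusion of the chart `U_σ` into `X`. -/
def chartι (S : Fan N) (σ : S.cones) :
    Spec (CommRingCat.of (coordRing k σ.1)) ⟶ toricVariety k S :=
  colimit.ι (charts k S) σ

instance (S : Fan N) (σ : S.cones) : IsOpenImmersion (chartι k S σ) :=
  inferInstanceAs (IsOpenImmersion (colimit.ι (charts k S) σ))

/-- The structure morphism `X ⟶ Spec k`. -/
def toricStr (S : Fan N) : toricVariety k S ⟶ Spec (CommRingCat.of k) :=
  colimit.desc (charts k S)
    { pt := Spec (CommRingCat.of k)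
      ι :=
        { app := fun σ => Spec.map (CommRingCat.ofHom (algebraMap k (coordRing k σ.1)))
          naturality := fun τ σ f => by
            dsimp [charts]
            rw [← Spec.map_comp, ← CommRingCat.ofHom_comp, Category.comp_id]
            congr 2
            exact AddMonoidAlgebra.mapDomainRingHom_comp_algebraMap _ } }

/-- The endomorphism of the diagram of charts given by `x^u ↦ x^{q u}`. -/
def frobCharts (q : ℕ) (S : Fan N) : charts k S ⟶ charts k S where
  app σ := Spec.map (CommRingCat.ofHom (mulRing k q σ.1))
  naturality τ σ f := by
    dsimp [charts]
    rw [← Spec.map_comp, ← Spec.map_comp, ← CommRingCat.ofHom_comp, ← CommRingCat.ofHom_comp]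
    congr 2
    refine AddMonoidAlgebra.ringHom_ext (fun c => ?_) (fun m => ?_) <;>
    · rw [RingHom.comp_apply, RingHom.comp_apply, resRing_single, mulRing_single, mulRing_single,
        resRing_single, map_nsmul]

/-- The morphism `F : X ⟶ X` induced by multiplication by `q` on `N`. -/
def toricFrob (q : ℕ) (S : Fan N) : toricVariety k S ⟶ toricVariety k S :=
  colimMap (frobCharts k q S)

lemma chartι_frob (q : ℕ) (S : Fan N) (σ : S.cones) :
    chartι k S σ ≫ toricFrob k q S =
      Spec.map (CommRingCat.ofHom (mulRing k q σ.1)) ≫ chartι k S σ :=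
  ι_colimMap _ _

lemma toric_hom_ext (S : Fan N) {Y : Scheme.{u}} {f g : toricVariety k S ⟶ Y}
    (h : ∀ σ, chartι k S σ ≫ f = chartι k S σ ≫ g) : f = g :=
  colimit.hom_ext h

lemma chartι_str (S : Fan N) (σ : S.cones) :
    chartι k S σ ≫ toricStr k S = Spec.map (CommRingCat.ofHom (algebraMap k (coordRing k σ.1))) :=
  colimit.ι_desc _ _

lemma toricFrob_str (q : ℕ) (S : Fan N) : toricFrob k q S ≫ toricStr k S = toricStr k S := by
  refine toric_hom_ext k S fun σ => ?_
  rw [← Category.assoc, chartι_frob, Category.assoc, chartι_str, ← Spec.map_comp, ← CommRingCat.ofHom_comp]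
  congr 2
  exact AddMonoidAlgebra.mapDomainRingHom_comp_algebraMap _

/-- The torus `T ⊆ X`, as an open subscheme: the chart of the cone `{0}`. -/
def torus (S : Fan N) : (toricVariety k S).Opens := chartι k S ⟨⊥, S.zero_mem⟩ ''ᵁ ⊤

/-- The character `x^u ∈ Γ(T, O)` for `u ∈ M`. -/
def character (S : Fan N) (u : latM N) : Γ(toricVariety k S, torus k S) :=
  ((chartι k S ⟨⊥, S.zero_mem⟩).appIso ⊤).inv
    ((Scheme.ΓSpecIso (CommRingCat.of (coordRing k (⊥ : PointedCone ℝ (NR N))))).inv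
      (AddMonoidAlgebra.single ⟨u.1, mem_dualMonoid_bot u.2⟩ 1))

lemma frob_preimage_torus {q : ℕ} (hq : q ≠ 0) (S : Fan N) :
    toricFrob k q S ⁻¹ᵁ torus k S ≤ torus k S := by
  intro x hx
  obtain ⟨σ, y, rfl⟩ := Scheme.IsLocallyDirected.ι_jointly_surjective (charts k S) x
  let o : S.cones := ⟨⊥, S.zero_mem⟩
  have ho : o ≤ σ := show (⊥ : PointedCone ℝ (NR N)) ≤ σ.1 from bot_le
  obtain ⟨m, hm⟩ := S.exists_face (τ := o) (σ := σ) ho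
  have hx2 : toricFrob k q S (chartι k S σ y) ∈ torus k S := hx
  have hy : toricFrob k q S (chartι k S σ y) =
      chartι k S σ (Spec.map (CommRingCat.ofHom (mulRing k q σ.1)) y) :=
    congr($(chartι_frob k q S σ) y)
  rw [hy] at hx2
  obtain ⟨z, -, hz⟩ := hx2
  obtain ⟨ρ, fo, fσ, w, rfl, hw⟩ := (Scheme.IsLocallyDirected.ι_eq_ι_iff (F := charts k S)).1
    (show colimit.ι (charts k S) o z = colimit.ι (charts k S) σ _ from hz)
  have hρ : ∀ x, x ∈ ρ.1 ↔ x ∈ σ.1 ∧ pair m.1 x = 0 := by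
    have : ρ.1 = o.1 := le_antisymm (leOfHom fo) bot_le
    rw [this]
    exact hm
  have h1 := (S.range_charts fσ hρ _).1 ⟨w, hw⟩
  have h2 : mulRing k q σ.1 (AddMonoidAlgebra.single m 1) ∉ PrimeSpectrum.asIdeal y := h1
  have h3 : (AddMonoidAlgebra.single m 1 : coordRing k σ.1) ∉ PrimeSpectrum.asIdeal y := by
    intro h
    apply h2
    have h4 : mulRing k q σ.1 (AddMonoidAlgebra.single m 1) = AddMonoidAlgebra.single m 1 ^ q := by
      rw [mulRing_single, AddMonoidAlgebra.single_pow, one_pow]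
    rw [h4]
    exact Ideal.pow_mem_of_mem _ h q (Nat.pos_of_ne_zero hq)
  obtain ⟨z, hz⟩ := (S.range_charts (homOfLE ho) hm y).2 h3
  refine ⟨z, trivial, ?_⟩
  rw [← hz]
  change colimit.ι (charts k S) o z = colimit.ι (charts k S) σ _
  rw [← Scheme.Hom.comp_apply, colimit.w]

end Toric

/-! ### Splittings on a scheme with an endomorphism -/

section Splittings

variable {Y : Scheme.{u}} (F : Y ⟶ Y)

/-- The structure sheaf of `Y`, as a sheaf of modules over itself. -/
def structureSheafModule (Y : Scheme.{u}) : Y.Modules := SheafOfModules.unit Y.ringCatSheaf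

/-- The maps of `O_Y`-modules `F_* O_Y ⟶ O_Y`. -/
abbrev FrobeniusMap : Type u :=
  (Scheme.Modules.pushforward F).obj (structureSheafModule Y) ⟶ structureSheafModule Y

variable {F}

/-- The action of `π : F_* O_Y ⟶ O_Y` on the sections over `U`, `Γ(U, F_* O_Y)` being
`Γ(F⁻¹ U, O_Y)`. -/
def FrobeniusMap.onSections (π : FrobeniusMap F) (U : Y.Opens) (s : Γ(Y, F ⁻¹ᵁ U)) : Γ(Y, U) :=
  Scheme.Modules.Hom.app π U s

lemma FrobeniusMap.onSections_add (π : FrobeniusMap F) (U : Y.Opens) (s t : Γ(Y, F ⁻¹ᵁ U)) :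
    π.onSections U (s + t) = π.onSections U s + π.onSections U t :=
  map_add (Scheme.Modules.Hom.app π U).hom s t

lemma FrobeniusMap.onSections_mul (π : FrobeniusMap F) (U : Y.Opens) (r : Γ(Y, U))
    (s : Γ(Y, F ⁻¹ᵁ U)) : π.onSections U (F.app U r * s) = r * π.onSections U s :=
  Scheme.Modules.Hom.app_smul π r s

lemma FrobeniusMap.onSections_res (π : FrobeniusMap F) {U V : Y.Opens} (h : U ≤ V)
    (s : Γ(Y, F ⁻¹ᵁ V)) :
    Y.presheaf.map (homOfLE h).op (π.onSections V s) =
      π.onSections U (Y.presheaf.map (homOfLE (F.preimage_mono h)).op s) :=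
  congr($((Scheme.Modules.Hom.mapPresheaf π).naturality (homOfLE h).op) s).symm

/-- `π : F_* O_Y ⟶ O_Y` is a splitting if its composition with `O_Y ⟶ F_* O_Y` is the identity. -/
def FrobeniusMap.IsSplitting (π : FrobeniusMap F) : Prop :=
  ∀ (U : Y.Opens) (s : Γ(Y, U)), π.onSections U (F.app U s) = s

/-- The ideal sheaf of a closed subset `Z` with its reduced structure: the sections over `U` that
vanish at all the points of `Z ∩ U`. -/
def vanishingSections (Z : Set Y) (U : Y.Opens) : Set Γ(Y, U) :=
  {s | ∀ x ∈ Z, x ∉ Y.basicOpen s}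

/-- `π` is compatible with `Z` if it maps `F_* I_Z` into `I_Z`. -/
def FrobeniusMap.IsCompatible (π : FrobeniusMap F) (Z : Set Y) : Prop :=
  ∀ (U : Y.Opens), ∀ s ∈ vanishingSections Z (F ⁻¹ᵁ U), π.onSections U s ∈ vanishingSections Z U

end Splittings

/-! ### The powers of a toric variety and their subdiagonals -/

section Power

variable (k : Type u) [Field k] {N : Type u} [AddCommGroup N] (S : Fan N) (n : ℕ)

/-- The `n`-fold fibre product `X^n` over `k`. -/
def power : Scheme.{u} :=
  widePullback (Spec (CommRingCat.of k)) (fun _ : Fin n => toricVariety k S)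
    (fun _ => toricStr k S)

/-- The projection of `X^n` to the factor with index `j`. -/
def proj (j : Fin n) : power k S n ⟶ toricVariety k S :=
  WidePullback.π (fun _ : Fin n => toricStr k S) j

/-- The structure morphism of `X^n`. -/
def powerStr : power k S n ⟶ Spec (CommRingCat.of k) :=
  WidePullback.base (fun _ : Fin n => toricStr k S)

lemma proj_str (j : Fin n) : proj k S n j ≫ toricStr k S = powerStr k S n :=
  WidePullback.π_arrow _ _

/-- The morphism `F : X^n ⟶ X^n` induced by multiplication by `q`: it is `F` on each factor. -/
def powerFrob (q : ℕ) : power k S n ⟶ power k S n :=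
  WidePullback.lift (powerStr k S n) (fun j => proj k S n j ≫ toricFrob k q S)
    (fun j => by rw [Category.assoc, toricFrob_str, proj_str])

lemma powerFrob_proj (q : ℕ) (j : Fin n) :
    powerFrob k S n q ≫ proj k S n j = proj k S n j ≫ toricFrob k q S :=
  WidePullback.lift_π _ _ _ _ _

/-- The subset of `X^n` where the coordinates with indices `i` and `j` agree: the preimage of the
diagonal `Δ ⊆ X × X` under the projection to these two factors. -/
def diagonalAt (i j : Fin n) : Set (power k S n) :=
  pullback.lift (proj k S n i) (proj k S n j)
      ((proj_str k S n i).trans (proj_str k S n j).symm) ⁻¹'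
    Set.range (pullback.diagonal (toricStr k S))

/-- The subdiagonal `X^i × Δ × X^(n - i - 2)`, with `0 ≤ i ≤ n - 2` (indices start from `0`). -/
def subdiagonal (i : ℕ) (hi : i + 1 < n) : Set (power k S n) :=
  diagonalAt k S n ⟨i, Nat.lt_of_succ_lt hi⟩ ⟨i + 1, hi⟩

/-- The union of the subdiagonals of `X^n`. -/
def subdiagonalUnion : Set (power k S n) := ⋃ (i : ℕ) (hi : i + 1 < n), subdiagonal k S n i hi

/-- The torus `T^n ⊆ X^n`. -/
def powerTorus : (power k S n).Opens := ⨅ j, proj k S n j ⁻¹ᵁ torus k S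

lemma powerTorus_le (j : Fin n) : powerTorus k S n ≤ proj k S n j ⁻¹ᵁ torus k S := iInf_le _ j

lemma powerFrob_preimage_torus {q : ℕ} (hq : q ≠ 0) :
    powerFrob k S n q ⁻¹ᵁ powerTorus k S n ≤ powerTorus k S n := by
  refine le_iInf fun j => ?_
  refine (Scheme.Hom.preimage_mono _ (powerTorus_le k S n j)).trans ?_
  rw [← Scheme.Hom.comp_preimage, powerFrob_proj, Scheme.Hom.comp_preimage]
  exact Scheme.Hom.preimage_mono _ (frob_preimage_torus k hq S)

/-- Scalars in `k`, as sections of the structure sheaf of `X^n`. -/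
def scalar (U : (power k S n).Opens) (c : k) : Γ(power k S n, U) :=
  (power k S n).presheaf.map (homOfLE (le_top : U ≤ ⊤)).op
    ((powerStr k S n).appTop ((Scheme.ΓSpecIso (CommRingCat.of k)).inv c))

variable (N)

/-- The lattice `M^n`. -/
def latMn : AddSubgroup (Fin n → MR N) := AddSubgroup.pi Set.univ fun _ => latM N

/-- The sublattice of `M^n` of the tuples `u` with `u_0 + ⋯ + u_{n-1} = 0` and `u_j = 0` for
`j ∉ {i, i + 1}` (indices start from `0`). -/
def latL (i : ℕ) : AddSubgroup (Fin n → MR N) where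
  carrier := {u | u ∈ latMn N n ∧ ∑ j, u j = 0 ∧ ∀ j : Fin n, j.1 ≠ i → j.1 ≠ i + 1 → u j = 0}
  add_mem' {a b} ha hb := ⟨add_mem ha.1 hb.1, by
    simp [Finset.sum_add_distrib, ha.2.1, hb.2.1],
    fun j h h' => by simp [ha.2.2 j h h', hb.2.2 j h h']⟩
  zero_mem' := ⟨zero_mem _, by simp, fun _ _ _ => rfl⟩
  neg_mem' {a} ha := ⟨neg_mem ha.1, by simp [ha.2.1], fun j h h' => by simp [ha.2.2 j h h']⟩

variable {N}

/-- `(1/q) L = {v | q v ∈ L}`. -/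
def frac {A : Type u} [AddCommGroup A] (q : ℕ) (L : AddSubgroup A) : AddSubgroup A :=
  L.comap (nsmulAddMonoidHom q)

/-- The monomial `x^u = ∏ x_j^{u_j} ∈ Γ(T^n, O)` for `u ∈ M^n`. -/
def monomial (u : latMn N n) : Γ(power k S n, powerTorus k S n) :=
  ∏ j, (power k S n).presheaf.map (homOfLE (powerTorus_le k S n j)).op
    ((proj k S n j).app (torus k S) (character k S ⟨u.1 j, u.2 j (Set.mem_univ j)⟩))

/-- The monomial `x^b ∈ Γ(T^n, F_* O) = Γ(F⁻¹ T^n, O)` for `b ∈ (1/q) M^n`. As `O ⟶ F_* O` is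
`x^u ↦ x^{q u}`, the function on `F⁻¹ T^n = T^n` which it stands for is `x^{q b}`. -/
def fracMonomial {q : ℕ} (hq : 2 ≤ q) (b : frac q (latMn N n)) :
    Γ(power k S n, powerFrob k S n q ⁻¹ᵁ powerTorus k S n) :=
  (power k S n).presheaf.map (homOfLE (powerFrob_preimage_torus k S n (by omega))).op
    (monomial k S n ⟨q • b.1, b.2⟩)

open Classical in
/-- The value `π_a(x^b)`: it is `x^{a+b}` if `a + b ∈ M^n`, and `0` otherwise. -/
def piValue {q : ℕ} (a b : frac q (latMn N n)) : Γ(power k S n, powerTorus k S n) :=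
  if h : a.1 + b.1 ∈ latMn N n then monomial k S n ⟨a.1 + b.1, h⟩ else 0

variable {k S n}

/-- `π = ∑ c_a π_a`, that is, `π` maps `x^b` to `∑ c_a π_a(x^b)` for all `b ∈ (1/q) M^n`. As the
monomials `x^b` form a basis of `Γ(T^n, F_* O)` over `k`, this determines `π` on `T^n`, and so
on `X^n`. -/
def IsCombination {q : ℕ} (hq : 2 ≤ q) (π : FrobeniusMap (powerFrob k S n q))
    (c : frac q (latMn N n) →₀ k) : Prop :=
  ∀ b, π.onSections (powerTorus k S n) (fracMonomial k S n hq b) =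
    c.sum fun a ca => scalar k S n _ ca * piValue k S n a b

open Classical in
/-- The sum of the `c_a` over the `a` with `a + b ∈ M^n` and `(a + b) mod L_i = w`. -/
def classSum {q : ℕ} (c : frac q (latMn N n) →₀ k) (i : ℕ) (b : frac q (latMn N n))
    (w : latMn N n ⧸ (latL N n i).addSubgroupOf (latMn N n)) : k :=
  ∑ a ∈ c.support with ∃ h : a.1 + b.1 ∈ latMn N n,
    (QuotientAddGroup.mk ⟨a.1 + b.1, h⟩ : latMn N n ⧸ (latL N n i).addSubgroupOf (latMn N n)) = w,
    c a

end Power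

end ToricSplitting

end

open ToricSplitting

/-! Compatibility with a subdiagonal can be tested on the torus, where it becomes linear algebra in
`k[M^n]`. Replacing coordinate i+1 by coordinate i is an endomorphism of X^n (`copyCoord`) whose
fixed points are exactly Δ_i (`mem_diagonalAt_iff`). On T^n = Spec k[M^n] it acts by x^u ↦ x^{ρ(u)},
where ρ (`collapse`) adds u_{i+1} to u_i and puts 0 in place i+1; the kernel of ρ is L_i. So a
function on T^n vanishes on Δ_i exactly when ρ kills its expansion, and these functions are spanned
by the differences x^u - x^v with u - v in L_i. Hence π preserves them if and only if π(x^b) and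
π(x^{b'}) have the same image under ρ whenever b - b' lies in (1/q)L_i. The coefficients of these
images are the two class sums of the theorem (`compatible_torus_iff`).

Two comparisons remain. Passing from T^n to X^n uses that T^n is affine, equals its own preimage
under F, and meets Δ_i in a dense subset: a section over another open set is extended to T^n after
clearing a denominator F^*f, and π is linear over such factors (`isCompatible_of_affineOpen`).
Passing from the union to a single Δ_i uses a function t on T^n that vanishes on every other Δ_j but
not identically on Δ_i. If s vanishes on Δ_i then F^*(t)s vanishes on the union, so tπ(s) vanishes
on Δ_i; as k[M^n] is a domain, π(s) does too (`compatible_torus_of_isCompatible`). -/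

noncomputable section

namespace ToricSplitting

/-! ### Density of the torus in X and in X^n -/

section Density

variable (k : Type u) [Field k] {N : Type u} [AddCommGroup N]

/-- Subgroups of a real vector space inherit unique sums, so their monoid algebras have no zero
divisors. For M^n this is what allows cancelling t at the end; for the charts it gives
irreducibility. -/
instance twoUniqueSums_pi_MR (n : ℕ) (L : AddSubgroup (Fin n → MR N)) : TwoUniqueSums L :=
  TwoUniqueSums.of_injective_addHom (L.subtype : L →ₙ+ (Fin n → MR N))
    Subtype.coe_injective inferInstance

instance twoUniqueSums_dualMonoid (σ : PointedCone ℝ (NR N)) : TwoUniqueSums (dualMonoid σ) :=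
  TwoUniqueSums.of_injective_addHom ((dualMonoid σ).subtype : dualMonoid σ →ₙ+ MR N)
    Subtype.coe_injective inferInstance

instance isDomain_coordRing (σ : PointedCone ℝ (NR N)) : IsDomain (coordRing k σ) :=
  NoZeroDivisors.to_isDomain _

/-- Each chart is irreducible, its ring being a domain, and contains the torus of the cone {0}. So a
nonempty open set meeting the chart meets the torus. -/
lemma dense_torus (S : Fan N) : Dense (torus k S : Set (toricVariety k S)) := by
  rw [dense_iff_inter_open]
  rintro V hV ⟨x, hx⟩
  obtain ⟨σ, y, rfl⟩ := Scheme.IsLocallyDirected.ι_jointly_surjective (charts k S) x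
  have : IsDomain (CommRingCat.of (coordRing k σ.1)) := isDomain_coordRing k σ.1
  let o : S.cones := ⟨⊥, S.zero_mem⟩
  have ho : o ≤ σ := show (⊥ : PointedCone ℝ (NR N)) ≤ σ.1 from bot_le
  have : IsDomain (CommRingCat.of (coordRing k o.1)) := isDomain_coordRing k o.1
  obtain ⟨z⟩ : Nonempty ((charts k S).obj o) :=
    inferInstanceAs (Nonempty (Spec (CommRingCat.of (coordRing k o.1))))
  have h1 : (chartι k S σ ⁻¹' V).Nonempty := ⟨y, hx⟩
  have h2 : (chartι k S σ ⁻¹' (torus k S : Set (toricVariety k S))).Nonempty := by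
    refine ⟨(charts k S).map (homOfLE ho) z, ⟨z, trivial, ?_⟩⟩
    exact congr($(colimit.w (charts k S) (homOfLE ho)) z).symm
  obtain ⟨w, hw1, hw2⟩ := nonempty_preirreducible_inter
    (hV.preimage (chartι k S σ).continuous)
    ((torus k S).isOpen.preimage (chartι k S σ).continuous) h1 h2
  exact ⟨_, hw1, hw2⟩

variable (S : Fan N) (n : ℕ)

/-- The fibre product of the factors of `X^n` with index different from `j`. -/
abbrev otherFactors (j : Fin n) : Scheme.{u} :=
  widePullback (Spec (CommRingCat.of k)) (fun _ : {l : Fin n // l ≠ j} => toricVariety k S)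
    (fun _ => toricStr k S)

/-- The structure morphism of the fibre product of the factors with index different from `j`. -/
abbrev otherFactorsStr (j : Fin n) : otherFactors k S n j ⟶ Spec (CommRingCat.of k) :=
  WidePullback.base (fun _ : {l : Fin n // l ≠ j} => toricStr k S)

lemma power_hom_ext {Y : Scheme.{u}} {f g : Y ⟶ power k S n}
    (h : ∀ j, f ≫ proj k S n j = g ≫ proj k S n j)
    (h' : f ≫ powerStr k S n = g ≫ powerStr k S n) : f = g :=
  WidePullback.hom_ext _ _ _ h h'

variable {k S n} in
/-- The morphism to `X^n` with given components. -/
def powerLift {Y : Scheme.{u}} (f : Y ⟶ Spec (CommRingCat.of k))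
    (fs : Fin n → (Y ⟶ toricVariety k S)) (w : ∀ j, fs j ≫ toricStr k S = f) : Y ⟶ power k S n :=
  WidePullback.lift f fs w

lemma powerLift_proj {Y : Scheme.{u}} (f : Y ⟶ Spec (CommRingCat.of k))
    (fs : Fin n → (Y ⟶ toricVariety k S)) (w : ∀ j, fs j ≫ toricStr k S = f) (j : Fin n) :
    powerLift f fs w ≫ proj k S n j = fs j :=
  WidePullback.lift_π _ _ _ _ _

lemma powerLift_str {Y : Scheme.{u}} (f : Y ⟶ Spec (CommRingCat.of k))
    (fs : Fin n → (Y ⟶ toricVariety k S)) (w : ∀ j, fs j ≫ toricStr k S = f) :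
    powerLift f fs w ≫ powerStr k S n = f :=
  WidePullback.lift_base _ _ _ _

/-- The projection from `X^n` to the factors with index different from `j`. -/
def projOthers (j : Fin n) : power k S n ⟶ otherFactors k S n j :=
  WidePullback.lift (powerStr k S n) (fun l => proj k S n l.1) (fun l => proj_str k S n l.1)

lemma projOthers_proj (j : Fin n) (l : {l : Fin n // l ≠ j}) :
    projOthers k S n j ≫ WidePullback.π (fun _ : {l : Fin n // l ≠ j} => toricStr k S) l =
      proj k S n l.1 :=
  WidePullback.lift_π _ _ _ _ _

lemma projOthers_str (j : Fin n) :
    projOthers k S n j ≫ otherFactorsStr k S n j = powerStr k S n :=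
  WidePullback.lift_base _ _ _ _

/-- Splitting off one factor makes the projection a base change of a morphism to Spec k, and such
morphisms are universally open. -/
lemma isPullback_proj (j : Fin n) :
    IsPullback (proj k S n j) (projOthers k S n j) (toricStr k S) (otherFactorsStr k S n j) := by
  classical
  refine ⟨⟨(proj_str k S n j).trans (projOthers_str k S n j).symm⟩,
    ⟨PullbackCone.IsLimit.mk _ (fun s => powerLift (s.fst ≫ toricStr k S)
      (fun l => if h : l = j then s.fst else
        s.snd ≫ WidePullback.π (fun _ : {l : Fin n // l ≠ j} => toricStr k S) ⟨l, h⟩) ?_)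
      ?_ ?_ ?_⟩⟩
  · intro l
    split_ifs with h
    · rfl
    · rw [Category.assoc, WidePullback.π_arrow, s.condition]
  · intro s
    rw [powerLift_proj, dif_pos rfl]
  · intro s
    refine WidePullback.hom_ext _ _ _ (fun l => ?_) ?_
    · rw [Category.assoc, projOthers_proj, powerLift_proj, dif_neg l.2]
    · rw [Category.assoc, projOthers_str, powerLift_str, s.condition]
  · intro s m h1 h2
    refine power_hom_ext k S n (fun l => ?_) ?_
    · rw [powerLift_proj]
      split_ifs with h
      · rw [h, h1]
      · rw [← h2, Category.assoc, projOthers_proj]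
    · rw [powerLift_str, ← h1, Category.assoc, proj_str]

lemma isOpenMap_proj (j : Fin n) : IsOpenMap (proj k S n j) := by
  have : IsDomain (CommRingCat.of k) := inferInstanceAs (IsDomain k)
  have : Subsingleton (Spec (CommRingCat.of k)) :=
    inferInstanceAs (Subsingleton (PrimeSpectrum k))
  have : UniversallyOpen (proj k S n j) :=
    MorphismProperty.of_isPullback (P := @UniversallyOpen) (isPullback_proj k S n j).flip
      (inferInstance : UniversallyOpen (otherFactorsStr k S n j))
  exact (proj k S n j).isOpenMap

lemma coe_powerTorus : (powerTorus k S n : Set (power k S n)) =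
    ⋂ j, proj k S n j ⁻¹' (torus k S : Set (toricVariety k S)) := by
  ext x
  simp only [powerTorus, TopologicalSpace.Opens.coe_iInf]
  rfl

/-- Preimages of dense sets under open maps are dense, and T^n is a finite intersection of dense
open preimages. -/
lemma dense_powerTorus : Dense (powerTorus k S n : Set (power k S n)) := by
  rw [coe_powerTorus]
  rw [← Set.sInter_range]
  refine (Set.finite_range _).dense_sInter ?_ ?_
  · rintro _ ⟨j, rfl⟩
    exact (torus k S).isOpen.preimage (proj k S n j).continuous
  · rintro _ ⟨j, rfl⟩
    exact (dense_torus k S).preimage (isOpenMap_proj k S n j)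

end Density

/-! ### Diagonals as fixed points of an endomorphism of X^n -/

section Subdiagonals

variable (k : Type u) [Field k] {N : Type u} [AddCommGroup N] (S : Fan N) (n : ℕ)

/-- The endomorphism of `X^n` which replaces the coordinate with index `j` by the one with
index `i`. -/
def copyCoord (i j : Fin n) : power k S n ⟶ power k S n :=
  powerLift (powerStr k S n) (fun l => proj k S n (if l = j then i else l))
    (fun _ => proj_str k S n _)

lemma copyCoord_proj (i j l : Fin n) :
    copyCoord k S n i j ≫ proj k S n l = proj k S n (if l = j then i else l) :=
  WidePullback.lift_π _ _ _ _ _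

lemma copyCoord_str (i j : Fin n) : copyCoord k S n i j ≫ powerStr k S n = powerStr k S n :=
  WidePullback.lift_base _ _ _ _

lemma powerFrob_str (q : ℕ) : powerFrob k S n q ≫ powerStr k S n = powerStr k S n :=
  WidePullback.lift_base _ _ _ _

lemma copyCoord_frob (q : ℕ) (i j : Fin n) :
    copyCoord k S n i j ≫ powerFrob k S n q = powerFrob k S n q ≫ copyCoord k S n i j := by
  refine power_hom_ext k S n (fun l => ?_) ?_
  · rw [Category.assoc, Category.assoc, powerFrob_proj, copyCoord_proj, powerFrob_proj,
      ← Category.assoc, copyCoord_proj]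
  · rw [Category.assoc, Category.assoc, powerFrob_str, copyCoord_str, powerFrob_str]

variable {k S n} in
lemma range_subset_diagonalAt {Y : Scheme.{u}} (f : Y ⟶ power k S n) {i j : Fin n}
    (h : f ≫ proj k S n i = f ≫ proj k S n j) (y : Y) : f y ∈ diagonalAt k S n i j := by
  have h' : (f ≫ proj k S n i) ≫ pullback.diagonal (toricStr k S) =
      f ≫ pullback.lift (proj k S n i) (proj k S n j)
        ((proj_str k S n i).trans (proj_str k S n j).symm) := by
    apply pullback.hom_ext
    · rw [Category.assoc, Category.assoc, pullback.diagonal_fst, Category.comp_id]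
      exact congrArg (f ≫ ·) (pullback.lift_fst _ _ _).symm
    · rw [Category.assoc, Category.assoc, pullback.diagonal_snd, Category.comp_id, h]
      exact congrArg (f ≫ ·) (pullback.lift_snd _ _ _).symm
  exact ⟨(f ≫ proj k S n i) y, congr($h' y)⟩

variable {k S n} in
/-- A point of the diagonal lies in the image of a morphism which equalizes the projections. -/
lemma exists_equalizer_of_mem_diagonalAt {i j : Fin n} {x : power k S n}
    (hx : x ∈ diagonalAt k S n i j) :
    ∃ (E : Scheme.{u}) (f : E ⟶ power k S n) (e : E), f e = x ∧
      f ≫ proj k S n i = f ≫ proj k S n j := by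
  obtain ⟨y, hy⟩ := hx
  obtain ⟨e, he, -⟩ := Scheme.Pullback.exists_preimage_pullback x y hy.symm
  refine ⟨_, _, e, he, ?_⟩
  have h := pullback.condition (f := pullback.lift (proj k S n i) (proj k S n j)
      ((proj_str k S n i).trans (proj_str k S n j).symm)) (g := pullback.diagonal (toricStr k S))
  have h1 := congr($h ≫ pullback.fst _ _)
  have h2 := congr($h ≫ pullback.snd _ _)
  simp only [Category.assoc, pullback.lift_fst, pullback.lift_snd, pullback.diagonal_fst,
    pullback.diagonal_snd] at h1 h2
  exact h1.trans h2.symm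

variable {k S n} in
lemma copyCoord_comp_eq_self {Y : Scheme.{u}} (f : Y ⟶ power k S n) {i j : Fin n}
    (h : f ≫ proj k S n i = f ≫ proj k S n j) : f ≫ copyCoord k S n i j = f := by
  refine power_hom_ext k S n (fun l => ?_) ?_
  · rw [Category.assoc, copyCoord_proj]
    split_ifs with hl
    · rw [h, hl]
    · rfl
  · rw [Category.assoc, copyCoord_str]

/-- A point of the diagonal lifts to a scheme on which the two projections agree, and there copying
a coordinate changes nothing. Conversely, the two projections agree after `copyCoord`, so its whole
image lies in the diagonal. -/
lemma mem_diagonalAt_iff (i j : Fin n) (x : power k S n) :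
    x ∈ diagonalAt k S n i j ↔ copyCoord k S n i j x = x := by
  constructor
  · intro hx
    obtain ⟨E, f, e, rfl, h⟩ := exists_equalizer_of_mem_diagonalAt hx
    rw [← Scheme.Hom.comp_apply, copyCoord_comp_eq_self f h]
  · intro hx
    rw [← hx]
    refine range_subset_diagonalAt _ ?_ x
    rw [copyCoord_proj, copyCoord_proj, if_pos rfl]
    split_ifs <;> rfl

lemma copyCoord_mem_diagonalAt (i j : Fin n) (x : power k S n) :
    copyCoord k S n i j x ∈ diagonalAt k S n i j := by
  refine range_subset_diagonalAt _ ?_ x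
  rw [copyCoord_proj, copyCoord_proj, if_pos rfl]
  split_ifs <;> rfl

/-- F acts by the same map on every factor, so it commutes with `copyCoord` and preserves its fixed
points. -/
lemma powerFrob_mem_diagonalAt (q : ℕ) {i j : Fin n} {x : power k S n}
    (hx : x ∈ diagonalAt k S n i j) : powerFrob k S n q x ∈ diagonalAt k S n i j := by
  rw [mem_diagonalAt_iff] at hx ⊢
  rw [← Scheme.Hom.comp_apply, ← copyCoord_frob, Scheme.Hom.comp_apply, hx]

lemma mem_powerTorus_iff (x : power k S n) :
    x ∈ powerTorus k S n ↔ ∀ j, proj k S n j x ∈ torus k S := by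
  rw [← SetLike.mem_coe, coe_powerTorus, Set.mem_iInter]
  rfl

lemma copyCoord_mem_powerTorus (i j : Fin n) {x : power k S n} (hx : x ∈ powerTorus k S n) :
    copyCoord k S n i j x ∈ powerTorus k S n := by
  rw [mem_powerTorus_iff] at hx ⊢
  intro l
  rw [← Scheme.Hom.comp_apply, copyCoord_proj]
  exact hx _

/-- The points of the diagonal which lie in the torus are dense in the diagonal. -/
lemma exists_mem_diagonalAt_inter_torus {i j : Fin n} {x : power k S n}
    (hx : x ∈ diagonalAt k S n i j) {V : (power k S n).Opens} (hxV : x ∈ V) :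
    ∃ y ∈ diagonalAt k S n i j, y ∈ powerTorus k S n ∧ y ∈ V := by
  rw [mem_diagonalAt_iff] at hx
  -- A torus point is chosen in the preimage of V and then moved into the diagonal by `copyCoord`,
  -- which preserves the torus.
  obtain ⟨z, hz, hz'⟩ := (dense_powerTorus k S n).inter_open_nonempty _
    (copyCoord k S n i j ⁻¹ᵁ V).isOpen ⟨x, show copyCoord k S n i j x ∈ V by rwa [hx]⟩
  exact ⟨_, copyCoord_mem_diagonalAt k S n i j z, copyCoord_mem_powerTorus k S n i j hz', hz⟩

lemma torus_le_frob_preimage (q : ℕ) : torus k S ≤ toricFrob k q S ⁻¹ᵁ torus k S := by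
  rintro _ ⟨z, -, rfl⟩
  change toricFrob k q S (chartι k S ⟨⊥, S.zero_mem⟩ z) ∈ torus k S
  rw [← Scheme.Hom.comp_apply, chartι_frob]
  exact ⟨_, trivial, rfl⟩

lemma powerFrob_preimage_torus_eq {q : ℕ} (hq : q ≠ 0) :
    powerFrob k S n q ⁻¹ᵁ powerTorus k S n = powerTorus k S n := by
  refine le_antisymm (powerFrob_preimage_torus k S n hq) fun x hx => ?_
  change powerFrob k S n q x ∈ powerTorus k S n
  rw [mem_powerTorus_iff] at hx ⊢
  intro j
  rw [← Scheme.Hom.comp_apply, powerFrob_proj]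
  exact torus_le_frob_preimage k S q (hx j)

end Subdiagonals

/-! ### Characters and scalars as functions on T -/

section TorusCoordinates

variable (k : Type u) [Field k]

lemma le_preimage_top {Y Z : Scheme.{u}} (f : Y ⟶ Z) (W : Y.Opens) : W ≤ f ⁻¹ᵁ ⊤ := le_top

/-- The ring map `k ⟶ Γ(Z, W)` for a scheme `Z` over `k`. -/
def scalarMap {Z : Scheme.{u}} (s : Z ⟶ Spec (CommRingCat.of k)) (W : Z.Opens) :
    CommRingCat.of k ⟶ Γ(Z, W) :=
  (Scheme.ΓSpecIso (CommRingCat.of k)).inv ≫ s.appLE ⊤ W (le_preimage_top s W)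

lemma scalarMap_appLE {Y Z : Scheme.{u}} (s : Z ⟶ Spec (CommRingCat.of k)) (f : Y ⟶ Z)
    (U : Z.Opens) (V : Y.Opens) (e : V ≤ f ⁻¹ᵁ U) :
    scalarMap k s U ≫ f.appLE U V e = scalarMap k (f ≫ s) V := by
  rw [scalarMap, scalarMap, Category.assoc, Scheme.Hom.appLE_comp_appLE]

lemma appLE_top_top {Y Z : Scheme.{u}} (f : Y ⟶ Z) :
    f.appLE ⊤ ⊤ (le_preimage_top f ⊤) = f.appTop :=
  Scheme.Hom.appLE_eq_app _

lemma scalarMap_Spec {R : CommRingCat.{u}} (f : CommRingCat.of k ⟶ R) :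
    scalarMap k (Spec.map f) ⊤ = f ≫ (Scheme.ΓSpecIso R).inv := by
  rw [scalarMap, Scheme.ΓSpecIso_inv_naturality, appLE_top_top]

variable {N : Type u} [AddCommGroup N] (S : Fan N)

/-- The ring `k[M]`. -/
abbrev torusRing (N : Type u) [AddCommGroup N] : CommRingCat.{u} :=
  CommRingCat.of (coordRing k (⊥ : PointedCone ℝ (NR N)))

/-- The inclusion of the torus into `X`. -/
def torusι : Spec (torusRing k N) ⟶ toricVariety k S := chartι k S ⟨⊥, S.zero_mem⟩

instance : IsOpenImmersion (torusι k S) :=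
  inferInstanceAs (IsOpenImmersion (chartι k S ⟨⊥, S.zero_mem⟩))

lemma torusι_str : torusι k S ≫ toricStr k S = Spec.map (CommRingCat.ofHom
    (algebraMap k (coordRing k (⊥ : PointedCone ℝ (NR N))))) :=
  chartι_str k S _

lemma top_le_torusι_preimage : ⊤ ≤ torusι k S ⁻¹ᵁ torus k S :=
  fun x _ => ⟨x, trivial, rfl⟩

/-- The functions on the torus as functions on its image in `X`. -/
def torusFunctions : Γ(Spec (torusRing k N), ⊤) ⟶ Γ(toricVariety k S, torus k S) :=
  ((chartι k S ⟨⊥, S.zero_mem⟩).appIso ⊤).inv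

lemma torusFunctions_appLE :
    torusFunctions k S ≫ (torusι k S).appLE (torus k S) ⊤ (top_le_torusι_preimage k S) = 𝟙 _ := by
  refine (Scheme.Hom.appIso_inv_appLE (chartι k S ⟨⊥, S.zero_mem⟩) (U := ⊤) (V := ⊤)
    (top_le_torusι_preimage k S)).trans ?_
  exact (Spec (torusRing k N)).presheaf.map_id _

lemma appLE_torusFunctions :
    (torusι k S).appLE (torus k S) ⊤ (top_le_torusι_preimage k S) ≫ torusFunctions k S = 𝟙 _ := by
  refine (Scheme.Hom.appLE_appIso_inv (chartι k S ⟨⊥, S.zero_mem⟩) (U := torus k S) (V := ⊤)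
    (top_le_torusι_preimage k S)).trans ?_
  exact (toricVariety k S).presheaf.map_id _

/-- The ring map `k[M] ⟶ Γ(T, O)`. -/
def characterRing : torusRing k N ⟶ Γ(toricVariety k S, torus k S) :=
  (Scheme.ΓSpecIso (torusRing k N)).inv ≫ torusFunctions k S

lemma characterRing_appLE :
    characterRing k S ≫ (torusι k S).appLE (torus k S) ⊤ (top_le_torusι_preimage k S) =
      (Scheme.ΓSpecIso (torusRing k N)).inv := by
  rw [characterRing, Category.assoc, torusFunctions_appLE, Category.comp_id]

lemma characterRing_algebraMap :
    CommRingCat.ofHom (algebraMap k (coordRing k (⊥ : PointedCone ℝ (NR N)))) ≫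
      characterRing k S = scalarMap k (toricStr k S) (torus k S) := by
  rw [characterRing, ← Category.assoc, ← scalarMap_Spec, ← torusι_str k S,
    ← scalarMap_appLE k (toricStr k S) (torusι k S) (torus k S) ⊤ (top_le_torusι_preimage k S),
    Category.assoc, appLE_torusFunctions, Category.comp_id]

/-- A morphism to `X` which factors through the torus is determined by the pullbacks of the
characters. -/
lemma eq_of_top_le_preimage_torus {Z : Scheme.{u}} (f : Z ⟶ toricVariety k S)
    (e : ⊤ ≤ f ⁻¹ᵁ torus k S) :
    f = Z.toSpecΓ ≫ Spec.map (characterRing k S ≫ f.appLE (torus k S) ⊤ e) ≫ torusι k S := by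
  obtain ⟨g, rfl⟩ : ∃ g, g ≫ torusι k S = f := by
    refine ⟨_, IsOpenImmersion.lift_fac (torusι k S) f ?_⟩
    rintro _ ⟨z, rfl⟩
    obtain ⟨y, -, hy⟩ := e (show z ∈ ⊤ from trivial)
    exact ⟨y, hy⟩
  rw [← Scheme.Hom.appLE_comp_appLE _ _ _ ⊤ _ (top_le_torusι_preimage k S) (le_preimage_top g ⊤),
    ← Category.assoc (characterRing k S), characterRing_appLE, Spec.map_comp, Category.assoc,
    appLE_top_top, ← Scheme.toSpecΓ_naturality_assoc, toSpecΓ_SpecMap_ΓSpecIso_inv_assoc]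

variable (n : ℕ)

/-- The ring `k[M^n]`. -/
abbrev latticeRing (N : Type u) [AddCommGroup N] (n : ℕ) : Type u :=
  AddMonoidAlgebra k (latMn N n)

lemma scalar_eq (U : (power k S n).Opens) (c : k) :
    scalar k S n U c = scalarMap k (powerStr k S n) U c := rfl

variable {k S n} in
/-- The pullback of a character is determined by the morphism. -/
lemma appLE_characterRing_congr {Z : Scheme.{u}} {f g : Z ⟶ toricVariety k S} (h : f = g)
    {W : Z.Opens} (ef : W ≤ f ⁻¹ᵁ torus k S) (eg : W ≤ g ⁻¹ᵁ torus k S) :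
    f.appLE (torus k S) W ef = g.appLE (torus k S) W eg := by
  subst h
  rfl

end TorusCoordinates

/-! ### The ring k[M^n] and the collapsing of exponents -/

section LatticeRing

variable {k : Type u} [Field k] {N : Type u} [AddCommGroup N] {n : ℕ}

/-- The inclusion of `M` in `M^n` as the factor with index `j`. -/
def coordSingle (j : Fin n) : dualMonoid (⊥ : PointedCone ℝ (NR N)) →+ latMn N n where
  toFun m := ⟨Pi.single j m.1, fun l _ => by
    rcases eq_or_ne l j with rfl | h
    · simp [m.2.1]
    · simp [h, zero_mem]⟩
  map_zero' := by ext1; simp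
  map_add' a b := by ext1; simp [Pi.single_add]

lemma sum_coordSingle (u : latMn N n) :
    ∑ j, coordSingle j ⟨u.1 j, mem_dualMonoid_bot (u.2 j (Set.mem_univ j))⟩ = u := by
  ext1
  rw [AddSubgroup.val_finsetSum]
  exact Finset.univ_sum_single u.1

variable (k)

/-- The ring map `k[M] ⟶ k[M^n]` given by the factor with index `j`. -/
def coordInclusion (j : Fin n) : torusRing k N ⟶ CommRingCat.of (latticeRing k N n) :=
  CommRingCat.ofHom (AddMonoidAlgebra.mapDomainRingHom k (coordSingle j))

lemma coordInclusion_single (j : Fin n) (m : dualMonoid (⊥ : PointedCone ℝ (NR N))) (c : k) :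
    coordInclusion k j (AddMonoidAlgebra.single m c) =
      AddMonoidAlgebra.single (coordSingle j m) c :=
  AddMonoidAlgebra.mapDomain_single

lemma prod_coordInclusion (u : latMn N n) :
    ∏ j, coordInclusion k j
      (AddMonoidAlgebra.single ⟨u.1 j, mem_dualMonoid_bot (u.2 j (Set.mem_univ j))⟩ 1) =
      (AddMonoidAlgebra.single u 1 : latticeRing k N n) := by
  have h := map_prod (AddMonoidAlgebra.of k (latMn N n)) (fun j => Multiplicative.ofAdd
    (coordSingle j ⟨u.1 j, mem_dualMonoid_bot (u.2 j (Set.mem_univ j))⟩)) Finset.univ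
  rw [← ofAdd_sum, sum_coordSingle] at h
  exact (Finset.prod_congr rfl fun j _ => coordInclusion_single k j _ _).trans h.symm

/-- The inclusion `k ⟶ k[M^n]`. -/
def latticeScalar (N : Type u) [AddCommGroup N] (n : ℕ) :
    CommRingCat.of k ⟶ CommRingCat.of (latticeRing k N n) :=
  CommRingCat.ofHom (algebraMap k (latticeRing k N n))

variable {k} in
-- The scalars and the n copies of k[M] generate k[M^n]. This reduces identities between ring maps
-- on T^n to one factor at a time.
lemma latticeRing_hom_ext {R : CommRingCat.{u}} {f g : CommRingCat.of (latticeRing k N n) ⟶ R}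
    (h : latticeScalar k N n ≫ f = latticeScalar k N n ≫ g)
    (h' : ∀ j, coordInclusion k j ≫ f = coordInclusion k j ≫ g) : f = g := by
  refine CommRingCat.hom_ext (AddMonoidAlgebra.ringHom_ext (fun c => ?_) (fun m => ?_))
  · exact congr($h c)
  · rw [← prod_coordInclusion k m, map_prod, map_prod]
    exact Finset.prod_congr rfl fun j _ => congr($(h' j) _)

lemma algebraMap_coordInclusion (j : Fin n) :
    CommRingCat.ofHom (algebraMap k (coordRing k (⊥ : PointedCone ℝ (NR N)))) ≫
      coordInclusion k j = latticeScalar k N n :=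
  CommRingCat.hom_ext (AddMonoidAlgebra.mapDomainRingHom_comp_algebraMap _)

/-- The endomorphism of `M^n` which moves the coordinate with index `m` to the index `ρ m`. -/
def collapse (ρ : Fin n → Fin n) : latMn N n →+ latMn N n where
  toFun u := ⟨fun l => ∑ m with ρ m = l, u.1 m, fun _ _ =>
    show _ ∈ latM N from sum_mem fun m _ => u.2 m (Set.mem_univ m)⟩
  map_zero' := by ext1; funext l; simp
  map_add' a b := by ext1; funext l; simp [Finset.sum_add_distrib]

lemma collapse_apply (ρ : Fin n → Fin n) (u : latMn N n) (l : Fin n) :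
    (collapse ρ u).1 l = ∑ m with ρ m = l, u.1 m := rfl

lemma collapse_coordSingle (ρ : Fin n → Fin n) (j : Fin n)
    (m : dualMonoid (⊥ : PointedCone ℝ (NR N))) :
    collapse ρ (coordSingle j m) = coordSingle (ρ j) m := by
  ext1
  funext l
  change ∑ p with ρ p = l, (Pi.single j m.1 : Fin n → MR N) p =
    (Pi.single (ρ j) m.1 : Fin n → MR N) l
  rw [Finset.sum_pi_single', Pi.single_apply]
  simp [eq_comm]

/-- The endomorphism of `k[M^n]` induced by `collapse ρ`. -/
def collapseRing (ρ : Fin n → Fin n) :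
    CommRingCat.of (latticeRing k N n) ⟶ CommRingCat.of (latticeRing k N n) :=
  CommRingCat.ofHom (AddMonoidAlgebra.mapDomainRingHom k (collapse ρ))

lemma collapseRing_single (ρ : Fin n → Fin n) (u : latMn N n) (c : k) :
    collapseRing k ρ (AddMonoidAlgebra.single u c) = AddMonoidAlgebra.single (collapse ρ u) c :=
  AddMonoidAlgebra.mapDomain_single

lemma coordInclusion_collapseRing (ρ : Fin n → Fin n) (j : Fin n) :
    coordInclusion k j ≫ collapseRing k ρ = coordInclusion (N := N) k (ρ j) := by
  refine CommRingCat.hom_ext (AddMonoidAlgebra.ringHom_ext (fun c => ?_) (fun m => ?_)) <;>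
  · change collapseRing k ρ (coordInclusion k j _) = coordInclusion k (ρ j) _
    rw [coordInclusion_single, collapseRing_single, coordInclusion_single, collapse_coordSingle]

lemma latticeScalar_collapseRing (ρ : Fin n → Fin n) :
    latticeScalar k N n ≫ collapseRing k ρ = latticeScalar k N n :=
  CommRingCat.hom_ext (AddMonoidAlgebra.mapDomainRingHom_comp_algebraMap _)

/-- The map of indices which sends `j` to `i` and fixes the other indices. -/
def moveIndex (i j : Fin n) (l : Fin n) : Fin n := if l = j then i else l

lemma sum_collapse (ρ : Fin n → Fin n) (u : latMn N n) :
    ∑ l, (collapse ρ u).1 l = ∑ l, u.1 l := by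
  simp only [collapse_apply]
  exact Finset.sum_fiberwise Finset.univ ρ u.1

/-- The kernel of the endomorphism of `M^n` which adds the coordinate with index `i + 1` to the
one with index `i` is `L_i`. -/
lemma collapse_eq_zero_iff {i : ℕ} (hi : i + 1 < n) (u : latMn N n) :
    collapse (moveIndex ⟨i, Nat.lt_of_succ_lt hi⟩ ⟨i + 1, hi⟩) u = 0 ↔ u.1 ∈ latL N n i := by
  set I : Fin n := ⟨i, Nat.lt_of_succ_lt hi⟩
  set J : Fin n := ⟨i + 1, hi⟩
  -- The fibre of `moveIndex I J` over such an `l` is `{l}`, and its fibre over `J` is empty.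
  have hother : ∀ l, l ≠ I → l ≠ J → (collapse (moveIndex I J) u).1 l = u.1 l := by
    intro l h1 h2
    rw [collapse_apply, Finset.sum_eq_single l]
    · intro m hm hml
      rw [Finset.mem_filter_univ, moveIndex] at hm
      grind
    · intro h
      exact absurd (by rw [Finset.mem_filter_univ, moveIndex, if_neg h2]) h
  have hJ : (collapse (moveIndex I J) u).1 J = 0 := by
    rw [collapse_apply]
    refine Finset.sum_eq_zero fun m hm => ?_
    rw [Finset.mem_filter_univ, moveIndex] at hm
    have : I ≠ J := by simp [I, J, Fin.ext_iff]
    grind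
  constructor
  · intro h
    refine ⟨u.2, ?_, fun l h1 h2 => ?_⟩
    · rw [← sum_collapse (moveIndex I J), h]
      simp
    · rw [← hother l (fun h' => h1 (by rw [h'])) (fun h' => h2 (by rw [h'])), h]
      rfl
  · rintro ⟨-, h1, h2⟩
    have h3 : ∀ l, l ≠ I → (collapse (moveIndex I J) u).1 l = 0 := by
      intro l hl
      by_cases h : l = J
      · rw [h, hJ]
      · rw [hother l hl h]
        exact h2 l (fun h' => hl (Fin.ext h')) (fun h' => h (Fin.ext h'))
    ext1
    funext l
    by_cases hl : l = I
    · rw [hl]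
      -- All other entries of the collapsed tuple vanish, so its entry at `I` is the total sum,
      -- which collapsing preserves and which is 0 on L_i.
      rw [← sum_collapse (moveIndex I J), Finset.sum_eq_single I (fun m _ hm => h3 m hm)
        (by simp)] at h1
      exact h1
    · exact h3 l hl

lemma collapse_eq_iff {i : ℕ} (hi : i + 1 < n) (u v : latMn N n) :
    collapse (moveIndex ⟨i, Nat.lt_of_succ_lt hi⟩ ⟨i + 1, hi⟩) u =
      collapse (moveIndex ⟨i, Nat.lt_of_succ_lt hi⟩ ⟨i + 1, hi⟩) v ↔
      u.1 - v.1 ∈ latL N n i := by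
  rw [← sub_eq_zero, ← map_sub, collapse_eq_zero_iff hi]
  rfl

/-- Thus u and its collapse always differ by an element of L_i, and the collapse serves as a
representative of the class of u. -/
lemma collapse_collapse (i j : Fin n) (u : latMn N n) :
    collapse (moveIndex i j) (collapse (moveIndex i j) u) = collapse (moveIndex i j) u := by
  have h : ∀ l, moveIndex i j (moveIndex i j l) = moveIndex i j l := by
    intro l
    unfold moveIndex
    split_ifs <;> simp_all
  conv_lhs => rw [← sum_coordSingle u]
  conv_rhs => rw [← sum_coordSingle u]
  simp only [map_sum, collapse_coordSingle, h]

end LatticeRing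

/-! ### The identification of T^n with Spec k[M^n] -/

section TorusOfPower

variable (k : Type u) [Field k] {N : Type u} [AddCommGroup N] (S : Fan N) (n : ℕ)

/-- The pullback of the functions on the torus to `T^n` under the projection with index `j`. -/
abbrev projAppLE (j : Fin n) :
    Γ(toricVariety k S, torus k S) ⟶ Γ(power k S n, powerTorus k S n) :=
  (proj k S n j).appLE (torus k S) (powerTorus k S n) (powerTorus_le k S n j)

lemma monomial_eq (u : latMn N n) : monomial k S n u = ∏ j, projAppLE k S n j
    (characterRing k S
      (AddMonoidAlgebra.single ⟨u.1 j, mem_dualMonoid_bot (u.2 j (Set.mem_univ j))⟩ 1)) := rfl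

lemma monomial_zero : monomial k S n 0 = 1 := by
  rw [monomial_eq]
  refine Finset.prod_eq_one fun j _ => ?_
  rw [show (AddMonoidAlgebra.single ⟨(0 : latMn N n).1 j, _⟩ 1 :
    coordRing k (⊥ : PointedCone ℝ (NR N))) = 1 from rfl, map_one, map_one]

lemma monomial_add (u v : latMn N n) :
    monomial k S n (u + v) = monomial k S n u * monomial k S n v := by
  rw [monomial_eq, monomial_eq, monomial_eq, ← Finset.prod_mul_distrib]
  refine Finset.prod_congr rfl fun j _ => ?_
  rw [← map_mul, ← map_mul, AddMonoidAlgebra.single_mul_single, one_mul]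
  rfl

/-- The ring map `k[M^n] ⟶ Γ(T^n, O)`, which sends `x^u` to the monomial `x^u`. -/
def monomialRing : CommRingCat.of (latticeRing k N n) ⟶ Γ(power k S n, powerTorus k S n) :=
  CommRingCat.ofHom (AddMonoidAlgebra.liftNCRingHom
    (scalarMap k (powerStr k S n) (powerTorus k S n)).hom
    { toFun := fun u => monomial k S n u.toAdd
      map_one' := monomial_zero k S n
      map_mul' := fun u v => monomial_add k S n u.toAdd v.toAdd }
    (fun _ _ => Commute.all _ _))

lemma monomialRing_single (u : latMn N n) (c : k) :
    monomialRing k S n (AddMonoidAlgebra.single u c) =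
      scalar k S n _ c * monomial k S n u :=
  AddMonoidAlgebra.liftNCRingHom_single _ _ (fun _ _ => Commute.all _ _) _ _

lemma monomialRing_single_one (u : latMn N n) :
    monomialRing k S n (AddMonoidAlgebra.single u 1) = monomial k S n u := by
  rw [monomialRing_single, scalar_eq, map_one, one_mul]

lemma latticeScalar_monomialRing :
    latticeScalar k N n ≫ monomialRing k S n =
      scalarMap k (powerStr k S n) (powerTorus k S n) := by
  ext c
  change monomialRing k S n (AddMonoidAlgebra.single 0 c) = _
  rw [monomialRing_single, monomial_zero, mul_one]
  rfl

lemma coordInclusion_monomialRing (j : Fin n) :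
    coordInclusion k j ≫ monomialRing k S n = characterRing k S ≫ projAppLE k S n j := by
  refine CommRingCat.hom_ext (AddMonoidAlgebra.ringHom_ext (fun c => ?_) (fun m => ?_))
  · have h := scalarMap_appLE k (toricStr k S) (proj k S n j) (torus k S) (powerTorus k S n)
      (powerTorus_le k S n j)
    rw [← characterRing_algebraMap, proj_str, ← latticeScalar_monomialRing,
      ← algebraMap_coordInclusion k j] at h
    exact congr($h c).symm
  · change monomialRing k S n (coordInclusion k j _) = projAppLE k S n j (characterRing k S _)
    rw [coordInclusion_single, monomialRing_single_one, monomial_eq,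
      Finset.prod_eq_single_of_mem j (Finset.mem_univ j)]
    · congr 3
      ext1
      exact Pi.single_eq_same (M := fun _ => MR N) j m.1
    · intro l _ hl
      have h : (⟨(coordSingle j m).1 l, mem_dualMonoid_bot
          ((coordSingle j m).2 l (Set.mem_univ l))⟩ : dualMonoid (⊥ : PointedCone ℝ (NR N))) = 0 :=
        Subtype.ext (Pi.single_eq_of_ne (M := fun _ => MR N) hl m.1)
      rw [h, ← AddMonoidAlgebra.one_def, map_one, map_one]

/-- The morphism `Spec k[M^n] ⟶ X^n`. -/
def latticeι : Spec (CommRingCat.of (latticeRing k N n)) ⟶ power k S n :=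
  powerLift (Spec.map (latticeScalar k N n))
    (fun j => Spec.map (coordInclusion k j) ≫ torusι k S) fun j => by
      rw [Category.assoc, torusι_str, ← Spec.map_comp, algebraMap_coordInclusion]

lemma latticeι_proj (j : Fin n) :
    latticeι k S n ≫ proj k S n j = Spec.map (coordInclusion k j) ≫ torusι k S :=
  powerLift_proj _ _ _ _ _ _ _

lemma latticeι_str : latticeι k S n ≫ powerStr k S n = Spec.map (latticeScalar k N n) :=
  powerLift_str _ _ _ _ _ _

lemma latticeι_mem (x : Spec (CommRingCat.of (latticeRing k N n))) :
    latticeι k S n x ∈ powerTorus k S n := by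
  rw [mem_powerTorus_iff]
  intro j
  rw [← Scheme.Hom.comp_apply, latticeι_proj]
  exact ⟨_, trivial, rfl⟩

lemma top_le_latticeι_preimage : ⊤ ≤ latticeι k S n ⁻¹ᵁ powerTorus k S n :=
  fun x _ => latticeι_mem k S n x

variable {k S n} in
lemma coordInclusion_monomialRing_appLE {Z : Scheme.{u}} (f : Z ⟶ power k S n) (W : Z.Opens)
    (e : W ≤ f ⁻¹ᵁ powerTorus k S n) (j : Fin n) (e' : W ≤ (f ≫ proj k S n j) ⁻¹ᵁ torus k S) :
    coordInclusion k j ≫ monomialRing k S n ≫ f.appLE (powerTorus k S n) W e =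
      characterRing k S ≫ (f ≫ proj k S n j).appLE (torus k S) W e' := by
  rw [← Category.assoc, coordInclusion_monomialRing, Category.assoc, Scheme.Hom.appLE_comp_appLE]

variable {k S n} in
lemma latticeScalar_monomialRing_appLE {Z : Scheme.{u}} (f : Z ⟶ power k S n) (W : Z.Opens)
    (e : W ≤ f ⁻¹ᵁ powerTorus k S n) :
    latticeScalar k N n ≫ monomialRing k S n ≫ f.appLE (powerTorus k S n) W e =
      scalarMap k (f ≫ powerStr k S n) W := by
  rw [← Category.assoc, latticeScalar_monomialRing, scalarMap_appLE]

variable {k S n} in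
lemma le_preimage_torus_of_le {Z : Scheme.{u}} {f : Z ⟶ power k S n} {W : Z.Opens}
    (e : W ≤ f ⁻¹ᵁ powerTorus k S n) (j : Fin n) : W ≤ (f ≫ proj k S n j) ⁻¹ᵁ torus k S :=
  fun _ hx => powerTorus_le k S n j (e hx)

lemma monomialRing_latticeι :
    monomialRing k S n ≫ (latticeι k S n).appLE (powerTorus k S n) ⊤
      (top_le_latticeι_preimage k S n) = (Scheme.ΓSpecIso _).inv := by
  refine latticeRing_hom_ext ?_ fun j => ?_
  · rw [latticeScalar_monomialRing_appLE, latticeι_str, scalarMap_Spec]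
  · have e := top_le_latticeι_preimage k S n
    have e' : ⊤ ≤ (Spec.map (coordInclusion k j) ≫ torusι k S) ⁻¹ᵁ torus k S :=
      fun _ _ => ⟨_, trivial, rfl⟩
    rw [coordInclusion_monomialRing_appLE _ _ e j (le_preimage_torus_of_le e j),
      appLE_characterRing_congr (latticeι_proj k S n j) _ e',
      ← Scheme.Hom.appLE_comp_appLE _ _ _ ⊤ _ (top_le_torusι_preimage k S) (le_preimage_top _ ⊤),
      ← Category.assoc, characterRing_appLE, Scheme.ΓSpecIso_inv_naturality, appLE_top_top]

variable {k S n} in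
-- A morphism into T^n is determined by the pullbacks of the monomials. Each component is recovered
-- from those of its own characters, so the equality is checked factor by factor.
lemma eq_of_top_le_preimage_powerTorus {Z : Scheme.{u}} (f : Z ⟶ power k S n)
    (e : ⊤ ≤ f ⁻¹ᵁ powerTorus k S n) :
    (Z.toSpecΓ ≫ Spec.map (monomialRing k S n ≫ f.appLE (powerTorus k S n) ⊤ e)) ≫
      latticeι k S n = f := by
  refine power_hom_ext k S n (fun j => ?_) ?_
  · conv_rhs => rw [eq_of_top_le_preimage_torus k S (f ≫ proj k S n j)
      (le_preimage_torus_of_le e j)]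
    rw [Category.assoc, Category.assoc, latticeι_proj, ← Spec.map_comp_assoc,
      coordInclusion_monomialRing_appLE]
  · rw [Category.assoc, Category.assoc, latticeι_str, ← Spec.map_comp,
      latticeScalar_monomialRing_appLE, scalarMap, Spec.map_comp, appLE_top_top,
      ← Scheme.toSpecΓ_naturality_assoc, toSpecΓ_SpecMap_ΓSpecIso_inv, Category.comp_id]

lemma opens_top_le_ι_preimage {Y : Scheme.{u}} (U : Y.Opens) : ⊤ ≤ U.ι ⁻¹ᵁ U :=
  fun x _ => x.2

lemma range_latticeι_subset :
    Set.range (latticeι k S n) ⊆ Set.range (powerTorus k S n).ι :=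
  Set.range_subset_iff.2 fun x => ⟨⟨_, latticeι_mem k S n x⟩, rfl⟩

/-- The torus `T^n` is `Spec k[M^n]`. -/
def powerTorusIso : (powerTorus k S n).toScheme ≅ Spec (CommRingCat.of (latticeRing k N n)) where
  hom := (powerTorus k S n).toScheme.toSpecΓ ≫ Spec.map (monomialRing k S n ≫
    (powerTorus k S n).ι.appLE (powerTorus k S n) ⊤ (opens_top_le_ι_preimage _))
  inv := IsOpenImmersion.lift (powerTorus k S n).ι (latticeι k S n)
    (range_latticeι_subset k S n)
  hom_inv_id := by
    rw [← cancel_mono (powerTorus k S n).ι, Category.assoc, IsOpenImmersion.lift_fac,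
      eq_of_top_le_preimage_powerTorus, Category.id_comp]
  inv_hom_id := by
    rw [Scheme.toSpecΓ_naturality_assoc, ← Spec.map_comp, Category.assoc, ← appLE_top_top,
      Scheme.Hom.appLE_comp_appLE]
    simp only [IsOpenImmersion.lift_fac]
    rw [monomialRing_latticeι, toSpecΓ_SpecMap_ΓSpecIso_inv]

lemma isAffineOpen_powerTorus : IsAffineOpen (powerTorus k S n) :=
  IsAffine.of_isIso (powerTorusIso k S n).hom

end TorusOfPower

/-! ### Functions on T^n vanishing on a diagonal -/

section Vanishing

variable (k : Type u) [Field k] {N : Type u} [AddCommGroup N] (S : Fan N) (n : ℕ)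

lemma isIso_opens_ι_appLE {Y : Scheme.{u}} (U : Y.Opens) :
    IsIso (U.ι.appLE U ⊤ (opens_top_le_ι_preimage U)) := by
  have h : U.ι.appLE U ⊤ (opens_top_le_ι_preimage U) = U.topIso.inv := by
    rw [Scheme.Opens.ι_appLE, Scheme.Opens.topIso_inv]
    rfl
  rw [h]
  infer_instance

/-- This is the statement that the monomials form a basis of the functions on T^n. Pullback along
`latticeι` is an isomorphism because `latticeι` identifies Spec k[M^n] with T^n, and its composite
with `monomialRing` is the canonical isomorphism. -/
instance isIso_monomialRing : IsIso (monomialRing k S n) := by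
  have h : (latticeι k S n).appLE (powerTorus k S n) ⊤ (top_le_latticeι_preimage k S n) =
      (powerTorus k S n).ι.appLE (powerTorus k S n) ⊤ (opens_top_le_ι_preimage _) ≫
        (powerTorusIso k S n).inv.appTop := by
    rw [← appLE_top_top, Scheme.Hom.appLE_comp_appLE]
    simp only [powerTorusIso, IsOpenImmersion.lift_fac]
  have h2 := isIso_opens_ι_appLE (powerTorus k S n)
  have h3 : IsIso ((latticeι k S n).appLE (powerTorus k S n) ⊤
      (top_le_latticeι_preimage k S n)) := by
    rw [h]
    exact IsIso.comp_isIso' h2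
      (inferInstance : IsIso ((powerTorusIso k S n).inv.app ⊤))
  have h4 := monomialRing_latticeι k S n
  rw [← IsIso.eq_comp_inv] at h4
  rw [h4]
  infer_instance

lemma monomialRing_bijective : Function.Bijective (monomialRing k S n) :=
  ConcreteCategory.bijective_of_isIso _

/-- The expansion of a function on `T^n` in monomials. -/
def expansion : Γ(power k S n, powerTorus k S n) ⟶ CommRingCat.of (latticeRing k N n) :=
  inv (monomialRing k S n)

lemma expansion_monomialRing (a : latticeRing k N n) :
    expansion k S n (monomialRing k S n a) = a :=
  congr($(IsIso.hom_inv_id (monomialRing k S n)) a)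

lemma monomialRing_expansion (g : Γ(power k S n, powerTorus k S n)) :
    monomialRing k S n (expansion k S n g) = g :=
  congr($(IsIso.inv_hom_id (monomialRing k S n)) g)

lemma powerTorus_le_copyCoord_preimage (i j : Fin n) :
    powerTorus k S n ≤ copyCoord k S n i j ⁻¹ᵁ powerTorus k S n :=
  fun _ hx => copyCoord_mem_powerTorus k S n i j hx

/-- The pullback of a character of factor l is the same character of factor `moveIndex i j l`; on
exponents this is `collapse`. -/
lemma monomialRing_copyCoord (i j : Fin n) :
    monomialRing k S n ≫ (copyCoord k S n i j).appLE (powerTorus k S n) (powerTorus k S n)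
      (powerTorus_le_copyCoord_preimage k S n i j) =
      collapseRing k (moveIndex i j) ≫ monomialRing k S n := by
  have e := powerTorus_le_copyCoord_preimage k S n i j
  refine latticeRing_hom_ext ?_ fun l => ?_
  · rw [latticeScalar_monomialRing_appLE, copyCoord_str, ← Category.assoc,
      latticeScalar_collapseRing, latticeScalar_monomialRing]
  · rw [coordInclusion_monomialRing_appLE _ _ e l (le_preimage_torus_of_le e l),
      appLE_characterRing_congr (copyCoord_proj k S n i j l) _ (powerTorus_le k S n _),
      ← Category.assoc, coordInclusion_collapseRing, coordInclusion_monomialRing]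
    rfl

/-- A function on `T^n` vanishes on the diagonal if and only if its expansion maps to zero
in the ring of the diagonal. -/
lemma monomialRing_mem_vanishingSections_iff (i j : Fin n) (a : latticeRing k N n) :
    monomialRing k S n a ∈ vanishingSections (diagonalAt k S n i j) (powerTorus k S n) ↔
      collapseRing k (moveIndex i j) a = 0 := by
  have h1 := Scheme.basicOpen_appLE (copyCoord k S n i j) (powerTorus k S n) (powerTorus k S n)
    (powerTorus_le_copyCoord_preimage k S n i j) (monomialRing k S n a)
  have h2 : (copyCoord k S n i j).appLE (powerTorus k S n) (powerTorus k S n)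
      (powerTorus_le_copyCoord_preimage k S n i j) (monomialRing k S n a) =
      monomialRing k S n (collapseRing k (moveIndex i j) a) :=
    congr($(monomialRing_copyCoord k S n i j) a)
  rw [h2] at h1
  constructor
  · intro h
    set d : CommRingCat.of (latticeRing k N n) := collapseRing k (moveIndex i j) a
    -- The image of `copyCoord` lies in the diagonal, so the pulled back function vanishes at every
    -- point. It is then zero because k[M^n] is reduced.
    have h3 : (power k S n).basicOpen (monomialRing k S n d) = ⊥ := by
      rw [h1, eq_bot_iff]
      intro x hx
      exact (h _ (copyCoord_mem_diagonalAt k S n i j x) hx.2).elim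
    have h4 := Scheme.basicOpen_appLE (latticeι k S n) ⊤ (powerTorus k S n)
      (top_le_latticeι_preimage k S n) (monomialRing k S n d)
    have h5 : (latticeι k S n).appLE (powerTorus k S n) ⊤ (top_le_latticeι_preimage k S n)
        (monomialRing k S n d) = (Scheme.ΓSpecIso _).inv d :=
      congr($(monomialRing_latticeι k S n) d)
    have h6 : IsReduced (Spec (CommRingCat.of (latticeRing k N n))) :=
      have : _root_.IsReduced (CommRingCat.of (latticeRing k N n)) :=
        inferInstanceAs (_root_.IsReduced (latticeRing k N n))
      inferInstance
    rw [h3, h5, Scheme.Hom.preimage_bot, inf_bot_eq, basicOpen_eq_bot_iff] at h4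
    exact (ConcreteCategory.bijective_of_isIso (Scheme.ΓSpecIso _).inv).1
      (h4.trans (map_zero _).symm)
  · intro h x hx hxa
    rw [mem_diagonalAt_iff] at hx
    have hxT := (power k S n).basicOpen_le _ hxa
    -- As `x` is fixed by `copyCoord`, nonvanishing at `x` passes to the pullback, which is the zero
    -- function.
    have h3 : x ∈ powerTorus k S n ⊓ copyCoord k S n i j ⁻¹ᵁ
        (power k S n).basicOpen (monomialRing k S n a) := by
      refine ⟨hxT, ?_⟩
      change copyCoord k S n i j x ∈ (power k S n).basicOpen (monomialRing k S n a)
      rwa [hx]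
    rw [← h1, h, map_zero, Scheme.basicOpen_zero] at h3
    exact h3

lemma mem_vanishingSections_iff (i j : Fin n) (g : Γ(power k S n, powerTorus k S n)) :
    g ∈ vanishingSections (diagonalAt k S n i j) (powerTorus k S n) ↔
      collapseRing k (moveIndex i j) (expansion k S n g) = 0 := by
  rw [← monomialRing_mem_vanishingSections_iff, monomialRing_expansion]

end Vanishing

/-! ### Functions on T^n and on its preimage under F -/

section Restriction

variable (k : Type u) [Field k] {N : Type u} [AddCommGroup N] (S : Fan N) (n : ℕ)

/-- The restriction of functions from `T^n` to `F⁻¹ T^n`. -/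
def resTorus {q : ℕ} (hq : q ≠ 0) : Γ(power k S n, powerTorus k S n) ⟶
    Γ(power k S n, powerFrob k S n q ⁻¹ᵁ powerTorus k S n) :=
  (power k S n).presheaf.map (homOfLE (powerFrob_preimage_torus k S n hq)).op

lemma resTorus_bijective {q : ℕ} (hq : q ≠ 0) : Function.Bijective (resTorus k S n hq) := by
  have h : homOfLE (powerFrob_preimage_torus k S n hq) =
    eqToHom (powerFrob_preimage_torus_eq k S n hq) := Subsingleton.elim _ _
  have : IsIso (resTorus k S n hq) := by
    rw [resTorus, h]
    infer_instance
  exact ConcreteCategory.bijective_of_isIso _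

lemma resTorus_mem_vanishingSections_iff {q : ℕ} (hq : q ≠ 0) (Z : Set (power k S n))
    (g : Γ(power k S n, powerTorus k S n)) :
    resTorus k S n hq g ∈ vanishingSections Z (powerFrob k S n q ⁻¹ᵁ powerTorus k S n) ↔
      g ∈ vanishingSections Z (powerTorus k S n) := by
  have h : (power k S n).basicOpen (resTorus k S n hq g) = (power k S n).basicOpen g := by
    rw [resTorus, Scheme.basicOpen_res, inf_eq_right, powerFrob_preimage_torus_eq k S n hq]
    exact Scheme.basicOpen_le _ g
  simp only [vanishingSections, Set.mem_ofPred_eq, h]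

/-- F is a morphism over k, so scalars are their own pullbacks; this makes π linear over k. -/
lemma frob_app_scalar {q : ℕ} (hq : q ≠ 0) (c : k) :
    (powerFrob k S n q).app (powerTorus k S n) (scalar k S n _ c) =
      resTorus k S n hq (scalar k S n _ c) := by
  have h1 := scalarMap_appLE k (powerStr k S n) (powerFrob k S n q) (powerTorus k S n) _ le_rfl
  have h2 : scalarMap k (powerStr k S n) (powerTorus k S n) ≫ resTorus k S n hq =
      scalarMap k (powerStr k S n) (powerFrob k S n q ⁻¹ᵁ powerTorus k S n) := by
    rw [scalarMap, resTorus, Category.assoc, Scheme.Hom.appLE_map]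
    rfl
  rw [powerFrob_str, ← Scheme.Hom.app_eq_appLE, ← h2] at h1
  exact congr($h1 c)

end Restriction

/-! ### From an affine open set to the whole scheme -/

section Localization

lemma vanishingSections_res {Y : Scheme.{u}} {Z : Set Y} {U V : Y.Opens} (h : V ≤ U) {s : Γ(Y, U)}
    (hs : s ∈ vanishingSections Z U) : Y.presheaf.map (homOfLE h).op s ∈ vanishingSections Z V := by
  intro x hx hxs
  rw [Scheme.basicOpen_res] at hxs
  exact hs x hx hxs.2

variable {Y : Scheme.{u}} {F : Y ⟶ Y}

/-- If `π` is compatible with `Z` over an affine open `T` whose preimage is affine and whose points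
in `Z` are dense in `Z`, then `π` is compatible with `Z`. -/
lemma FrobeniusMap.isCompatible_of_affineOpen (π : FrobeniusMap F) {Z : Set Y} {T : Y.Opens}
    (hT : IsAffineOpen T) (hFT : IsAffineOpen (F ⁻¹ᵁ T))
    (hdense : ∀ x ∈ Z, ∀ V : Y.Opens, x ∈ V → ∃ y ∈ Z, y ∈ T ∧ y ∈ V)
    (h : ∀ s ∈ vanishingSections Z (F ⁻¹ᵁ T), π.onSections T s ∈ vanishingSections Z T) :
    π.IsCompatible Z := by
  intro U s hs x hx hxs
  obtain ⟨y, hyZ, hyT, hys⟩ := hdense x hx _ hxs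
  -- Suppose π(s) is nonzero at a point of Z. By density this also happens at some y in Z ∩ T, and y
  -- has a neighbourhood D(f) on which π(s) is invertible.
  obtain ⟨f, hfs, hyf⟩ := hT.exists_basicOpen_le (V := Y.basicOpen (π.onSections U s)) ⟨y, hys⟩ hyT
  have hDT : Y.basicOpen f ≤ T := Y.basicOpen_le f
  have hDU : Y.basicOpen f ≤ U := hfs.trans (Y.basicOpen_le _)
  have hFD : F ⁻¹ᵁ Y.basicOpen f = Y.basicOpen (F.app T f) := Scheme.preimage_basicOpen F f
  let s' : Γ(Y, F ⁻¹ᵁ Y.basicOpen f) := Y.presheaf.map (homOfLE (F.preimage_mono hDU)).op s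
  let f' : Γ(Y, Y.basicOpen f) := Y.presheaf.map (homOfLE hDT).op f
  let res : Γ(Y, F ⁻¹ᵁ T) ⟶ Γ(Y, F ⁻¹ᵁ Y.basicOpen f) :=
    Y.presheaf.map (homOfLE (F.preimage_mono hDT)).op
  have hs' : s' ∈ vanishingSections Z (F ⁻¹ᵁ Y.basicOpen f) := vanishingSections_res _ hs
  have hf' : res (F.app T f) = F.app (Y.basicOpen f) f' :=
    congr($(F.naturality (homOfLE hDT).op) f).symm
  -- F⁻¹D(f) is the basic open set of F^*f in the affine F⁻¹T, so s becomes a function g on F⁻¹T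
  -- after multiplication by a power of F^*f.
  obtain ⟨m, g, hg⟩ : ∃ (m : ℕ) (g : Γ(Y, F ⁻¹ᵁ T)),
      s' * res (F.app T f) ^ m = res g := by
    let _ := res.hom.toAlgebra
    have : IsLocalization.Away (F.app T f) Γ(Y, F ⁻¹ᵁ Y.basicOpen f) :=
      hFT.isLocalization_of_eq_basicOpen (F.app T f) (homOfLE (F.preimage_mono hDT)) hFD
    exact IsLocalization.Away.surj (F.app T f) s'
  -- g is only known to vanish on Z inside F⁻¹D(f); the extra factor F^*f takes care of the points
  -- outside.
  have hvan : F.app T f * g ∈ vanishingSections Z (F ⁻¹ᵁ T) := by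
    intro z hz hzb
    rw [Scheme.basicOpen_mul, ← hFD] at hzb
    have h1 : z ∈ Y.basicOpen (res g) := by
      rw [Scheme.basicOpen_res]
      exact hzb
    rw [← hg, Scheme.basicOpen_mul] at h1
    exact hs' z hz h1.1
  have hy : y ∉ Y.basicOpen (π.onSections T g) := fun hyg => by
    refine h _ hvan y hyZ ?_
    rw [π.onSections_mul, Scheme.basicOpen_mul]
    exact ⟨hyf, hyg⟩
  apply hy
  have hpow : F.app (Y.basicOpen f) f' ^ m = F.app (Y.basicOpen f) (f' ^ m) := (map_pow _ _ _).symm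
  -- On D(f), π(g) = f^m π(s), which is nonzero at y. This contradicts `hy`.
  have h2 : Y.presheaf.map (homOfLE hDT).op (π.onSections T g) =
      f' ^ m * Y.presheaf.map (homOfLE hDU).op (π.onSections U s) := by
    rw [π.onSections_res hDT, π.onSections_res hDU, ← π.onSections_mul, ← hpow, ← hf', mul_comm]
    exact congrArg _ hg.symm
  have h3 : y ∈ Y.basicOpen (Y.presheaf.map (homOfLE hDT).op (π.onSections T g)) := by
    have hu : IsUnit f' := RingedSpace.isUnit_res_basicOpen _ f
    rw [h2, Scheme.basicOpen_mul, Scheme.basicOpen_res, Scheme.basicOpen_of_isUnit _ (hu.pow m)]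
    exact ⟨hyf, hyf, hys⟩
  rw [Scheme.basicOpen_res] at h3
  exact h3.2

end Localization

/-! ### Class sums as coefficients -/

section ClassSums

variable (k : Type u) [Field k] {N : Type u} [AddCommGroup N] (n : ℕ)

variable {k n} in
open Classical in
/-- The sum of the terms `c_a x^{ρ(a + b)}` with `a + b ∈ M^n`, for `ρ = collapse _`. -/
def collapsedSum {q : ℕ} (ρ : Fin n → Fin n) (c : frac q (latMn N n) →₀ k)
    (b : frac q (latMn N n)) : latticeRing k N n :=
  c.sum fun a ca => if h : a.1 + b.1 ∈ latMn N n then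
    AddMonoidAlgebra.single (collapse ρ ⟨a.1 + b.1, h⟩) ca else 0

open Classical in
lemma coeff_collapsedSum {q : ℕ} (ρ : Fin n → Fin n) (c : frac q (latMn N n) →₀ k)
    (b : frac q (latMn N n)) (w : latMn N n) :
    (collapsedSum ρ c b).coeff w =
      ∑ a ∈ c.support with ∃ h : a.1 + b.1 ∈ latMn N n, collapse ρ ⟨a.1 + b.1, h⟩ = w, c a := by
  rw [collapsedSum, Finsupp.sum, AddMonoidAlgebra.coeff_sum, Finsupp.finsetSum_apply,
    Finset.sum_filter]
  refine Finset.sum_congr rfl fun a _ => ?_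
  by_cases h : a.1 + b.1 ∈ latMn N n
  · rw [dif_pos h, AddMonoidAlgebra.coeff_single, Finsupp.single_apply]
    simp [h]
  · rw [dif_neg h]
    simp [h]

/-- The fibres of `collapse` are the cosets of L_i, so summing over a class amounts to reading off a
coefficient after collapsing. -/
lemma classSum_mk {q i : ℕ} (hi : i + 1 < n) (c : frac q (latMn N n) →₀ k)
    (b : frac q (latMn N n)) (u : latMn N n) :
    classSum c i b (QuotientAddGroup.mk u) =
      (collapsedSum (moveIndex ⟨i, Nat.lt_of_succ_lt hi⟩ ⟨i + 1, hi⟩) c b).coeff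
        (collapse (moveIndex ⟨i, Nat.lt_of_succ_lt hi⟩ ⟨i + 1, hi⟩) u) := by
  classical
  rw [coeff_collapsedSum, classSum]
  refine Finset.sum_congr ?_ fun _ _ => rfl
  refine Finset.filter_congr fun a _ => exists_congr fun h => ?_
  rw [collapse_eq_iff hi, QuotientAddGroup.eq_iff_sub_mem]
  rfl

/-- Coefficients at exponents outside the image of `collapse` are 0 on both sides, so the class sums
determine the whole element. -/
lemma classSum_eq_iff {q i : ℕ} (hi : i + 1 < n) (c : frac q (latMn N n) →₀ k)
    (b b' : frac q (latMn N n)) :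
    (∀ u, classSum c i b u = classSum c i b' u) ↔
      collapsedSum (moveIndex ⟨i, Nat.lt_of_succ_lt hi⟩ ⟨i + 1, hi⟩) c b =
        collapsedSum (moveIndex ⟨i, Nat.lt_of_succ_lt hi⟩ ⟨i + 1, hi⟩) c b' := by
  classical
  constructor
  · intro h
    ext w
    by_cases hw : ∃ u, collapse (moveIndex ⟨i, Nat.lt_of_succ_lt hi⟩ ⟨i + 1, hi⟩) u = w
    · obtain ⟨u, rfl⟩ := hw
      rw [← classSum_mk, ← classSum_mk, h]
    · rw [coeff_collapsedSum, coeff_collapsedSum, Finset.sum_eq_zero, Finset.sum_eq_zero]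
      · intro a ha
        obtain ⟨h, h'⟩ := (Finset.mem_filter.1 ha).2
        exact (hw ⟨_, h'⟩).elim
      · intro a ha
        obtain ⟨h, h'⟩ := (Finset.mem_filter.1 ha).2
        exact (hw ⟨_, h'⟩).elim
  · intro h u
    obtain ⟨u, rfl⟩ := QuotientAddGroup.mk_surjective u
    rw [classSum_mk k n hi, classSum_mk k n hi, h]

end ClassSums

/-! ### Compatibility over T^n, and the union against its components -/

section TorusCompatibility

variable {k : Type u} [Field k] {N : Type u} [AddCommGroup N] {S : Fan N} {n q : ℕ}

lemma expansion_scalar_mul_monomial (c : k) (u : latMn N n) :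
    expansion k S n (scalar k S n _ c * monomial k S n u) = AddMonoidAlgebra.single u c := by
  rw [← monomialRing_single, expansion_monomialRing]

lemma expansion_onSections_fracMonomial {hq : 2 ≤ q} {π : FrobeniusMap (powerFrob k S n q)}
    {c : frac q (latMn N n) →₀ k} (hc : IsCombination hq π c) (ρ : Fin n → Fin n)
    (b : frac q (latMn N n)) :
    collapseRing k ρ (expansion k S n (π.onSections _ (fracMonomial k S n hq b))) =
      collapsedSum ρ c b := by
  rw [hc b, Finsupp.sum, map_sum, map_sum, collapsedSum, Finsupp.sum]
  refine Finset.sum_congr rfl fun a _ => ?_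
  rw [piValue]
  split_ifs with h
  · rw [expansion_scalar_mul_monomial, collapseRing_single]
  · rw [mul_zero, map_zero, map_zero]

variable (k S n) in
/-- The image of `a ∈ k[M^n] ≃ Γ(T^n, F_* O)` under `π`, in the ring of the diagonal. -/
def collapsedImage (hq : q ≠ 0) (π : FrobeniusMap (powerFrob k S n q)) (ρ : Fin n → Fin n) :
    latticeRing k N n →+ latticeRing k N n where
  toFun a := collapseRing k ρ (expansion k S n (π.onSections _
    (resTorus k S n hq (monomialRing k S n a))))
  map_zero' := by
    have h : π.onSections (powerTorus k S n) 0 = 0 := by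
      simpa using π.onSections_add (powerTorus k S n) 0 0
    rw [map_zero, map_zero, h, map_zero, map_zero]
  map_add' a b := by
    rw [map_add, map_add, π.onSections_add, map_add, map_add]

lemma collapsedImage_apply (hq : q ≠ 0) (π : FrobeniusMap (powerFrob k S n q))
    (ρ : Fin n → Fin n) (a : latticeRing k N n) : collapsedImage k S n hq π ρ a =
      collapseRing k ρ (expansion k S n (π.onSections _
        (resTorus k S n hq (monomialRing k S n a)))) := rfl

/-- A scalar is the pullback of itself under F and so comes out of π; monomials with coefficient 1
therefore suffice. -/
lemma collapsedImage_single (hq : q ≠ 0) (π : FrobeniusMap (powerFrob k S n q))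
    (ρ : Fin n → Fin n) (u : latMn N n) (c : k) :
    collapsedImage k S n hq π ρ (AddMonoidAlgebra.single u c) =
      AddMonoidAlgebra.single 0 c * collapsedImage k S n hq π ρ (AddMonoidAlgebra.single u 1) := by
  have h : collapseRing k ρ (expansion k S n (scalar k S n _ c)) =
      (AddMonoidAlgebra.single 0 c : latticeRing k N n) := by
    rw [← mul_one (scalar k S n _ c), ← monomial_zero, expansion_scalar_mul_monomial,
      collapseRing_single, map_zero]
  rw [collapsedImage_apply, collapsedImage_apply, monomialRing_single, monomialRing_single_one,
    map_mul, ← frob_app_scalar, π.onSections_mul, map_mul, map_mul, h]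

lemma collapsedImage_single_one (hq : 2 ≤ q) {π : FrobeniusMap (powerFrob k S n q)}
    {c : frac q (latMn N n) →₀ k} (hc : IsCombination hq π c) (ρ : Fin n → Fin n)
    (b : frac q (latMn N n)) :
    collapsedImage k S n (by omega) π ρ (AddMonoidAlgebra.single ⟨q • b.1, b.2⟩ 1) =
      collapsedSum ρ c b := by
  rw [← expansion_onSections_fracMonomial hc, collapsedImage_apply, monomialRing_single_one]
  rfl

/-- Every `u ∈ M^n` is `q b` for some `b ∈ (1/q) M^n`. -/
lemma exists_nsmul_eq (hq : q ≠ 0) (u : latMn N n) :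
    ∃ b : frac q (latMn N n), (⟨q • b.1, b.2⟩ : latMn N n) = u := by
  have h : q • ((q : ℝ)⁻¹ • u.1) = u.1 := by
    rw [← Nat.cast_smul_eq_nsmul ℝ, smul_smul, mul_inv_cancel₀ (by exact_mod_cast hq), one_smul]
  refine ⟨⟨(q : ℝ)⁻¹ • u.1, ?_⟩, Subtype.ext h⟩
  change q • ((q : ℝ)⁻¹ • u.1) ∈ latMn N n
  rw [h]
  exact u.2

/-- Compatibility with a subdiagonal over `T^n`, in terms of the class sums. -/
lemma compatible_torus_iff (hq : 2 ≤ q) {π : FrobeniusMap (powerFrob k S n q)}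
    {c : frac q (latMn N n) →₀ k} (hc : IsCombination hq π c) {i : ℕ} (hi : i + 1 < n) :
    (∀ s ∈ vanishingSections (subdiagonal k S n i hi) (powerFrob k S n q ⁻¹ᵁ powerTorus k S n),
      π.onSections _ s ∈ vanishingSections (subdiagonal k S n i hi) (powerTorus k S n)) ↔
    ∀ b b' : frac q (latMn N n), b.1 - b'.1 ∈ frac q (latL N n i) →
      ∀ u, classSum c i b u = classSum c i b' u := by
  have hq0 : q ≠ 0 := by omega
  set ρ := moveIndex (⟨i, Nat.lt_of_succ_lt hi⟩ : Fin n) ⟨i + 1, hi⟩ with hρ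
  have h1 : (∀ s ∈ vanishingSections (subdiagonal k S n i hi)
        (powerFrob k S n q ⁻¹ᵁ powerTorus k S n),
      π.onSections _ s ∈ vanishingSections (subdiagonal k S n i hi) (powerTorus k S n)) ↔
      ∀ a : latticeRing k N n, collapseRing k ρ a = 0 → collapsedImage k S n hq0 π ρ a = 0 := by
    rw [((resTorus_bijective k S n hq0).comp (monomialRing_bijective k S n)).2.forall]
    refine forall_congr' fun a => ?_
    rw [Function.comp_apply, resTorus_mem_vanishingSections_iff, subdiagonal,
      monomialRing_mem_vanishingSections_iff, mem_vanishingSections_iff, collapsedImage_apply]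
  have hmem : ∀ b b' : frac q (latMn N n), b.1 - b'.1 ∈ frac q (latL N n i) ↔
      collapse ρ ⟨q • b.1, b.2⟩ = collapse ρ ⟨q • b'.1, b'.2⟩ := by
    intro b b'
    rw [hρ, collapse_eq_iff hi, ← smul_sub]
    rfl
  have h2 : ∀ b b' : frac q (latMn N n), b.1 - b'.1 ∈ frac q (latL N n i) →
      ((∀ u, classSum c i b u = classSum c i b' u) ↔
        collapsedImage k S n hq0 π ρ (AddMonoidAlgebra.single ⟨q • b.1, b.2⟩ 1) =
          collapsedImage k S n hq0 π ρ (AddMonoidAlgebra.single ⟨q • b'.1, b'.2⟩ 1)) := by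
    intro b b' _
    rw [classSum_eq_iff k n hi, collapsedImage_single_one hq hc, collapsedImage_single_one hq hc]
  rw [h1]
  constructor
  · intro h b b' hb
    -- Compatibility is applied to the binomial x^{qb} - x^{qb'}, which vanishes on Δ_i.
    rw [h2 b b' hb, ← sub_eq_zero, ← map_sub]
    apply h
    rw [map_sub, collapseRing_single, collapseRing_single, (hmem b b').1 hb, sub_self]
  · intro h
    -- The collapsed image of π depends only on the collapse of its argument. By linearity this is a
    -- comparison of x^u with x^{ρ(u)}; dividing both exponents by q gives b and b' differing by an
    -- element of (1/q)L_i.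
    have h3 : ∀ a : latticeRing k N n, collapsedImage k S n hq0 π ρ a =
        collapsedImage k S n hq0 π ρ (collapseRing k ρ a) := by
      intro a
      induction a using AddMonoidAlgebra.induction_linear with
      | zero => rw [map_zero, map_zero, map_zero]
      | add x y hx hy => rw [map_add, map_add, map_add, hx, hy]
      | single u d =>
        obtain ⟨b, hb⟩ := exists_nsmul_eq hq0 u
        obtain ⟨b', hb'⟩ := exists_nsmul_eq hq0 (collapse ρ u)
        have h4 : b.1 - b'.1 ∈ frac q (latL N n i) := by
          rw [hmem, hb, hb', collapse_collapse]
        have h5 := (h2 b b' h4).1 (h b b' h4)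
        rw [hb, hb'] at h5
        rw [collapseRing_single, collapsedImage_single, h5, ← collapsedImage_single]
    intro a ha
    rw [h3, ha, map_zero]

/-- An element of `L_j` with entries `m` and `-m`. -/
def latLElement (m : MR N) (n j : ℕ) : Fin n → MR N :=
  fun l => if l.1 = j then m else if l.1 = j + 1 then -m else 0

lemma latLElement_mem_latMn {m : MR N} (hm : m ∈ latM N) (j : ℕ) :
    latLElement m n j ∈ latMn N n := by
  intro l _
  change latLElement m n j l ∈ latM N
  unfold latLElement
  split_ifs
  exacts [hm, neg_mem hm, zero_mem _]

lemma latLElement_mem {m : MR N} (hm : m ∈ latM N) {j : ℕ} (hj : j + 1 < n) :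
    latLElement m n j ∈ latL N n j := by
  refine ⟨latLElement_mem_latMn hm j, ?_, fun l h1 h2 => ?_⟩
  · have h : ∀ l : Fin n, latLElement m n j l =
        (if l = ⟨j, Nat.lt_of_succ_lt hj⟩ then m else 0) + if l = ⟨j + 1, hj⟩ then -m else 0 := by
      intro l
      simp only [latLElement, Fin.ext_iff]
      split_ifs <;> first | omega | simp
    simp only [h, Finset.sum_add_distrib, Finset.sum_ite_eq', Finset.mem_univ, if_true,
      add_neg_cancel]
  · rw [latLElement, if_neg h1, if_neg h2]

lemma latLElement_notMem {m : MR N} (hm : m ≠ 0) {i j : ℕ} (hj : j + 1 < n) (hij : j ≠ i) :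
    latLElement m n j ∉ latL N n i := by
  rintro ⟨-, -, h⟩
  -- An entry outside the indices i and i+1 must be nonzero. The entry at j serves unless j = i+1,
  -- and then the one at j+1 = i+2 does.
  by_cases h' : j = i + 1
  · have := h ⟨j + 1, hj⟩ (by simp; omega) (by simp; omega)
    simp [latLElement, hm] at this
  · have := h ⟨j, Nat.lt_of_succ_lt hj⟩ hij h'
    simp [latLElement, hm] at this

/-- There is a function on `T^n` which vanishes on all the subdiagonals but the one with index `i`,
and not identically on this one. -/
lemma exists_vanishing_off_subdiagonal {m : MR N} (hm : m ∈ latM N) (hm0 : m ≠ 0) {i : ℕ}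
    (hi : i + 1 < n) : ∃ t : Γ(power k S n, powerTorus k S n),
      (∀ (j : ℕ) (hj : j + 1 < n), j ≠ i →
        t ∈ vanishingSections (subdiagonal k S n j hj) (powerTorus k S n)) ∧
      collapseRing k (moveIndex ⟨i, Nat.lt_of_succ_lt hi⟩ ⟨i + 1, hi⟩) (expansion k S n t) ≠ 0 := by
  let v : ℕ → latMn N n := fun j => ⟨latLElement m n j, latLElement_mem_latMn hm j⟩
  let d : ℕ → latticeRing k N n :=
    fun j => AddMonoidAlgebra.single (v j) 1 - AddMonoidAlgebra.single 0 1
  have hd : ∀ (ρ : Fin n → Fin n) (j : ℕ), collapseRing k ρ (d j) =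
      (AddMonoidAlgebra.single (collapse ρ (v j)) 1 - AddMonoidAlgebra.single 0 1 :
        latticeRing k N n) := by
    intro ρ j
    rw [map_sub, collapseRing_single, collapseRing_single, map_zero]
  -- t is the product over j ≠ i of the binomials x^{v_j} - 1. The factor for j vanishes on Δ_j
  -- since v_j lies in L_j. None becomes zero on Δ_i since v_j is not in L_i, and a product of
  -- nonzero elements of a domain is nonzero.
  refine ⟨monomialRing k S n (∏ j ∈ (Finset.range (n - 1)).erase i, d j), ?_, ?_⟩
  · intro j hj hji
    rw [subdiagonal, monomialRing_mem_vanishingSections_iff, map_prod]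
    refine Finset.prod_eq_zero (i := j) (by simp [hji]; omega) ?_
    rw [hd, (collapse_eq_zero_iff hj (v j)).2 (latLElement_mem hm hj), sub_self]
  · rw [expansion_monomialRing, map_prod]
    refine Finset.prod_ne_zero_iff (M₀ := latticeRing k N n) |>.2 fun j hj => ?_
    rw [Finset.mem_erase, Finset.mem_range] at hj
    rw [hd, sub_ne_zero]
    intro h
    refine latLElement_notMem hm0 (by omega : j + 1 < n) hj.1
      ((collapse_eq_zero_iff hi (v j)).1 ?_)
    exact AddMonoidAlgebra.of_injective (R := k) (M := latMn N n)
      (a₁ := Multiplicative.ofAdd _) (a₂ := Multiplicative.ofAdd 0) h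

/-- A map compatible with the union of the subdiagonals is compatible with each of them
over `T^n`. -/
lemma compatible_torus_of_isCompatible {m : MR N} (hm : m ∈ latM N) (hm0 : m ≠ 0)
    {π : FrobeniusMap (powerFrob k S n q)} (h : π.IsCompatible (subdiagonalUnion k S n)) {i : ℕ}
    (hi : i + 1 < n) {s : Γ(power k S n, powerFrob k S n q ⁻¹ᵁ powerTorus k S n)}
    (hs : s ∈ vanishingSections (subdiagonal k S n i hi)
      (powerFrob k S n q ⁻¹ᵁ powerTorus k S n)) :
    π.onSections _ s ∈ vanishingSections (subdiagonal k S n i hi) (powerTorus k S n) := by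
  obtain ⟨t, ht, hti⟩ := exists_vanishing_off_subdiagonal (k := k) (S := S) hm hm0 hi
  -- On Δ_j with j ≠ i the factor F^*t vanishes, because F maps Δ_j into itself; on Δ_i it is s that
  -- vanishes.
  have h1 : (powerFrob k S n q).app (powerTorus k S n) t * s ∈
      vanishingSections (subdiagonalUnion k S n) (powerFrob k S n q ⁻¹ᵁ powerTorus k S n) := by
    intro x hx hxb
    rw [Scheme.basicOpen_mul, ← Scheme.preimage_basicOpen] at hxb
    simp only [subdiagonalUnion, Set.mem_iUnion] at hx
    obtain ⟨j, hj, hx⟩ := hx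
    by_cases hji : j = i
    · subst hji
      exact hs x hx hxb.2
    · exact ht j hj hji _ (powerFrob_mem_diagonalAt k S n q hx) hxb.1
  have h2 := h _ _ h1
  rw [π.onSections_mul] at h2
  have h3 : t * π.onSections _ s ∈
      vanishingSections (subdiagonal k S n i hi) (powerTorus k S n) :=
    fun x hx => h2 x (Set.mem_iUnion₂.2 ⟨i, hi, hx⟩)
  rw [subdiagonal, mem_vanishingSections_iff] at h3 ⊢
  rw [map_mul, map_mul] at h3
  exact (mul_eq_zero (M₀ := latticeRing k N n).1 h3).resolve_left hti

lemma isCompatible_subdiagonal_of_torus (hq : q ≠ 0) {π : FrobeniusMap (powerFrob k S n q)} {i : ℕ}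
    (hi : i + 1 < n)
    (h : ∀ s ∈ vanishingSections (subdiagonal k S n i hi)
        (powerFrob k S n q ⁻¹ᵁ powerTorus k S n),
      π.onSections _ s ∈ vanishingSections (subdiagonal k S n i hi) (powerTorus k S n)) :
    π.IsCompatible (subdiagonal k S n i hi) := by
  refine π.isCompatible_of_affineOpen (isAffineOpen_powerTorus k S n) ?_ ?_ h
  · rw [powerFrob_preimage_torus_eq k S n hq]
    exact isAffineOpen_powerTorus k S n
  · exact fun x hx V hV => exists_mem_diagonalAt_inter_torus k S n hx hV

lemma eq_of_latM_eq_bot (hq : q ≠ 0) (h : ∀ m ∈ latM N, m = 0) (b b' : frac q (latMn N n)) :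
    b = b' := by
  have key : ∀ b : frac q (latMn N n), b.1 = 0 := by
    intro b
    funext l
    have h1 : q • b.1 l = 0 := h _ (b.2 l (Set.mem_univ l))
    rw [← Nat.cast_smul_eq_nsmul ℝ] at h1
    exact (smul_eq_zero.1 h1).resolve_left (by exact_mod_cast hq)
  exact Subtype.ext ((key b).trans (key b').symm)

end TorusCompatibility

end ToricSplitting

end

open ToricSplitting
theorem mainTheorem9 {k : Type u} [Field k]
    {N : Type u} [AddCommGroup N] [Module.Free ℤ N] [Module.Finite ℤ N]
    (S : Fan N) (hS : S.IsComplete) (n q : ℕ) (hq : 2 ≤ q)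
    (π : FrobeniusMap (powerFrob k S n q)) (hπ : π.IsSplitting)
    (c : frac q (latMn N n) →₀ k)
    (hc : IsCombination hq π c) :
    π.IsCompatible (subdiagonalUnion k S n) ↔
      ∀ i : ℕ, i + 1 < n → ∀ b b' : frac q (latMn N n),
        b.1 - b'.1 ∈ frac q (latL N n i) →
        ∀ u : latMn N n ⧸ (latL N n i).addSubgroupOf (latMn N n),
          classSum c i b u = classSum c i b' u := by
  have hq0 : q ≠ 0 := by omega
  constructor
  · intro h i hi
    -- Building t requires a nonzero m. If M = 0, then (1/q)M^n = 0 as well, so b = b' and the two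
    -- class sums coincide.
    by_cases hM : ∃ m ∈ latM N, m ≠ 0
    · obtain ⟨m, hm, hm0⟩ := hM
      exact (compatible_torus_iff hq hc hi).1
        fun s hs => compatible_torus_of_isCompatible hm hm0 h hi hs
    · push Not at hM
      intro b b' _ u
      rw [eq_of_latM_eq_bot hq0 hM b b']
  · intro h U s hs x hx
    simp only [subdiagonalUnion, Set.mem_iUnion] at hx
    obtain ⟨i, hi, hx⟩ := hx
    -- The ideal of the union is the intersection of the ideals of the Δ_i, so compatibility with
    -- each of them suffices.
    exact isCompatible_subdiagonal_of_torus hq0 hi ((compatible_torus_iff hq hc hi).2 (h i hi)) U s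
      (fun y hy => hs y (Set.mem_iUnion₂.2 ⟨i, hi, hy⟩)) x hx
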